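/- **Setting.** Identify the natural numbers with the finite binary words by $0\mapsto\epsilon$, $1\mapsto 0$, $2\mapsto 1$, $3\mapsto 00,\dots$, write $|x|$ for the length of the word $x$, and let $\langle x,y\rangle = 1^{|x|}0xy$. Machines are deterministic multitape Turing machines with one input/output tape and a single halting state. Write $T(w)=u$ if $T$, started on input $w$, halts with output $u$. A Turing machine is *reversible* if every instantaneous description has at most one predecessor and the start state is never entered; for a reversible machine $R$, $R(w)=u$ means in addition that at the end $u$ is the only thing left on the tapes. Let $U$ be any universal Turing machine, i.e. for every Turing machine $T$ there is a word $i$ such that $U(\langle\langle i,p\rangle,y\rangle)=T(\langle p,y\rangle)$ for all $p,y$ (both sides being possibly undefined). Put $$C(x|y)=\min\{|p| : U(\langle p,y\rangle)=x\},\qquad C(x)=C(x|\epsilon),$$ and, for a time bound $t:\mathbb N\to\mathbb N$, $$C^t(x)=\min\{|p| : U(\langle p,\epsilon\rangle)=x \text{ in at most } t(|x|) \text{ steps}\}$$ ($\infty$ if there is no such $p$). For a reversible Turing machine $R$ put $E_R(x,y)=\min\{|p|+|q| : R(\langle x,p\rangle)=\langle y,q\rangle\}$. Let $UR$ be any reversible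 Turing machine whose cost function is universal, i.e. for every reversible Turing machine $R$ there is a constant $c_R$ with $E_{UR}(x,y)\le E_R(x,y)+c_R$ for all $x,y$, and put $E(x,y)=E_{UR}(x,y)$, the irreversibility cost of computing $y$ from $x$. **Corollary.** Up to an additive constant which does not depend on $x$, the irreversibility cost of erasing $x$ satisfies $$E(x,\epsilon)\ \ge\ \lim_{t\to\infty}C^t(x)=C(x),$$ where $C(x)$ is finite, and the limit is meant for each fixed $x$, along any sequence of time bounds $t_n$ with $t_n(|x|)\to\infty$; the equality with the limit is exact. Moreover $E(x,\epsilon)=C(x)$ up to an additional logarithmic term: there is a constant $c$, independent of $x$, with $$C(x)-c\ \le\ E(x,\epsilon)\ \le\ C(x)+c\,\bigl(C(C(x)\,|\,x)+1\bigr)\quad\text{and}\quad E(x,\epsilon)\ \le\ C(x)+c\,\bigl(\lfloor\log_2 \max(C(x),1)\rfloor+1\bigr)$$ for all words $x$. -/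

import Mathlib

open Filter Topology

namespace RevComp

/-- Tape symbols: the blank, the two bits, and finitely many auxiliary storage symbols. -/
inductive Sym (A : Type) : Type
  | blank : Sym A
  | bit (b : Bool) : Sym A
  | aux (a : A) : Sym A

instance (A : Type) : Inhabited (Sym A) := ⟨Sym.blank⟩

/-- A deterministic multitape Turing machine with tapes `0, …, k`, where tape `0` is the
input/output tape. A control state is an element of `Option Q`, and `none` is the unique halting
state. In state `q`, when the scanned symbols are `s`, the value `δ q s = some (q', a)` means:
enter state `q'`, and on each tape `i` write the symbol `(a i).1` and then move the head as
`(a i).2` says (`none` is no move). If `δ q s = none`, the machine is stuck (no output). -/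
structure TM : Type 1 where
  Q : Type
  finQ : Finite Q
  A : Type
  finA : Finite A
  k : ℕ
  start : Q
  δ : Q → (Fin (k + 1) → Sym A) →
    Option (Option Q × (Fin (k + 1) → Sym A × Option Turing.Dir))

/-- Instantaneous descriptions: control state and all tapes, with head positions. -/
@[ext] structure Cfg (M : TM) : Type where
  state : Option M.Q
  tape : Fin (M.k + 1) → Turing.Tape (Sym M.A)

/-- Write a symbol on the scanned square and then perform a move. -/
def act {A : Type} (a : Sym A × Option Turing.Dir) (T : Turing.Tape (Sym A)) :
    Turing.Tape (Sym A) :=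
  match a.2 with
  | none => T.write a.1
  | some d => (T.write a.1).move d

/-- The tape that holds the binary word `w` and is blank elsewhere, with the head on the first
symbol of `w`. -/
def wordTape (A : Type) (w : List Bool) : Turing.Tape (Sym A) :=
  Turing.Tape.mk₁ (w.map Sym.bit)

namespace TM

variable (M : TM)

/-- One computation step. -/
def step (c : Cfg M) : Option (Cfg M) :=
  match c.state with
  | none => none
  | some q =>
    match M.δ q (fun i => (c.tape i).head) with
    | none => none
    | some (q', a) => some ⟨q', fun i => act (a i) (c.tape i)⟩

/-- The description reached after exactly `n` steps, if the machine makes that many. -/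
def run : ℕ → Cfg M → Option (Cfg M)
  | 0, c => some c
  | n + 1, c => (M.step c).bind (run n)

/-- A description in which tape `0` holds the word `w` and all the other tapes are blank. -/
def cleanCfg (q : Option M.Q) (w : List Bool) : Cfg M :=
  ⟨q, fun i => if i = 0 then wordTape M.A w else wordTape M.A []⟩

/-- The initial description on input `w`. -/
def init (w : List Bool) : Cfg M := M.cleanCfg (some M.start) w

/-- `M(w) = u` in at most `n` steps: `M` halts with `u` on the output tape; whatever is left on
the other tapes is ignored. -/
def OutputsWithin (w u : List Bool) (n : ℕ) : Prop :=
  ∃ m ≤ n, ∃ c, M.run m (M.init w) = some c ∧ c.state = none ∧ c.tape 0 = wordTape M.A u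

/-- `M(w) = u`. -/
def Outputs (w u : List Bool) : Prop := ∃ n, M.OutputsWithin w u n

/-- `M(w) = u` with nothing but `u` left in the memory: `M` halts with `u` on the output tape and
all the other tapes blank. -/
def OutputsClean (w u : List Bool) : Prop := ∃ m, M.run m (M.init w) = some (M.cleanCfg none u)

/-- `M` is a reversible Turing machine: each instantaneous description has at most one
predecessor, and the start state is never entered (just as the halting state is never left). -/
def Reversible : Prop :=
  (∀ c₁ c₂ c, M.step c₁ = some c → M.step c₂ = some c → c₁ = c₂) ∧
    ∀ c₁ c, M.step c₁ = some c → c.state ≠ some M.start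

end TM

/-- The pairing `⟨x, y⟩ = 1^{|x|} 0 x y` of binary words. -/
def pair (x y : List Bool) : List Bool := List.replicate x.length true ++ false :: (x ++ y)

/-- The identification `0 ↦ ε, 1 ↦ 0, 2 ↦ 1, 3 ↦ 00, 4 ↦ 01, …` of `ℕ` with the binary words:
the binary expansion of `n + 1` without its leading digit `1`. -/
def word (n : ℕ) : List Bool := (Nat.bits (n + 1)).dropLast.reverse

/-- `U` is a universal Turing machine: for each Turing machine `T` there is an index `i` with
`U(⟨⟨i, p⟩, y⟩) = T(⟨p, y⟩)` for all `p` and `y` (also as to being undefined). -/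
def IsUniversal (U : TM) : Prop :=
  ∀ T : TM, ∃ i : List Bool, ∀ p y u : List Bool,
    U.Outputs (pair (pair i p) y) u ↔ T.Outputs (pair p y) u

/-- The conditional Kolmogorov complexity `C(x|y)` with respect to `U`
(`⊤` if no program computes `x` from `y`). -/
noncomputable def condC (U : TM) (x y : List Bool) : ℕ∞ :=
  ⨅ (p : List Bool) (_ : U.Outputs (pair p y) x), (p.length : ℕ∞)

/-- The Kolmogorov complexity `C(x) = C(x|ε)`. -/
noncomputable def C (U : TM) (x : List Bool) : ℕ∞ := condC U x []

/-- The `t`-time-limited conditional Kolmogorov complexity `C^t(x|y)` with respect to `U`. -/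
noncomputable def condCt (U : TM) (t : ℕ → ℕ) (x y : List Bool) : ℕ∞ :=
  ⨅ (p : List Bool) (_ : U.OutputsWithin (pair p y) x (t x.length)), (p.length : ℕ∞)

/-- The `t`-time-limited Kolmogorov complexity `C^t(x) = C^t(x|ε)`. -/
noncomputable def Ct (U : TM) (t : ℕ → ℕ) (x : List Bool) : ℕ∞ := condCt U t x []

/-- The irreversibility cost `E_R(x, y)`: the least `|p| + |q|` with `R(⟨x, p⟩) = ⟨y, q⟩`. -/
noncomputable def E (R : TM) (x y : List Bool) : ℕ∞ :=
  ⨅ (p : List Bool) (q : List Bool) (_ : R.OutputsClean (pair x p) (pair y q)),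
    ((p.length + q.length : ℕ) : ℕ∞)

/-- `UR` is a reversible Turing machine and `E_UR` is a universal irreversibility cost function:
it is minimal, up to an additive constant, among those of all reversible Turing machines. -/
def IsUniversalReversible (UR : TM) : Prop :=
  UR.Reversible ∧
    ∀ R : TM, R.Reversible → ∃ c : ℕ, ∀ x y : List Bool, E UR x y ≤ E R x y + c

end RevComp

/-! Lower bound: a reversible machine is injective on words. If it maps `⟨x, p⟩` to `⟨ε, q⟩`, then
`x` can be recovered from `q` by searching for a start `⟨x', p'⟩` and a time at which the machine
stops on `⟨ε, q⟩`; by injectivity the search can only find `x`. Hence `C(x) ≤ |q| + O(1)`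
(`IsUniversal.exists_C_le_E`).

Upper bound: let `p` compute `C(x)` from `x`. Given `⟨x, p⟩`, search for a program `z` of length
`C(x)` for `x`, and output `⟨ε, ⟨p, z⟩⟩`. This is undone by running `z`, so it is a partial
computable map with a computable inverse, and such a map is realised by a reversible machine
(`exists_reversible`). Its cost is `|p| + |⟨p, z⟩| = C(x) + 3|p| + 1`. A shortest `p` gives the
first bound, and `C(n|x) ≤ log n + O(1)` gives the logarithmic one.

Limit: a shortest program for `x` halts after some number of steps; once the time bound exceeds it,
`C^t(x) = C(x)` exactly.

The bulk of the proof relates concrete machines to recursive functions. In one direction, a run of a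
Turing machine is primitive recursive in the number of steps, so each search above is given by a
`Turing.ToPartrec.Code` (`exists_search_code`). In the other direction, a code is compiled to
Mathlib's stack machine, which is run on tapes by an `LM`. Bennett's method makes this reversible:
keep a history, copy the output, and run backwards to remove the history (`evaluator_computes`).
Composing the evaluator of `f` with the inverse of the evaluator of `g = f⁻¹` then erases the input
as well. Reversible machines are handled in quadruple form (`RM`), where inversion and composition
are immediate. -/

namespace RevComp

open Relation Function

/-! ### Reversible machines in quadruple form: inversion and composition -/

/-- Move the head as prescribed, where `none` stands for no move. -/
def shift {Γ : Type} [Inhabited Γ] (d : Option Turing.Dir) (T : Turing.Tape Γ) : Turing.Tape Γ :=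
  match d with
  | none => T
  | some d => T.move d

/-- The opposite of a head movement. -/
def flipDir : Option Turing.Dir → Option Turing.Dir
  | none => none
  | some .left => some .right
  | some .right => some .left

theorem flipDir_flipDir (d : Option Turing.Dir) : flipDir (flipDir d) = d := by
  rcases d with _ | _ | _ <;> rfl

theorem shift_flipDir {Γ : Type} [Inhabited Γ] (d : Option Turing.Dir) (T : Turing.Tape Γ) :
    shift (flipDir d) (shift d T) = T := by
  rcases d with _ | _ | _ <;> simp [shift, flipDir]

/-- The instructions of a machine in quadruple form: rewrite the vector of scanned symbols,
or move the heads. -/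
inductive Instr (ι Γ : Type) : Type
  | write (s s' : ι → Γ) : Instr ι Γ
  | move (d : ι → Option Turing.Dir) : Instr ι Γ

namespace Instr

variable {ι Γ : Type}

/-- The effect of an instruction on the tapes. -/
def Rel [Inhabited Γ] : Instr ι Γ → (ι → Turing.Tape Γ) → (ι → Turing.Tape Γ) → Prop
  | write s s', τ, τ' => (∀ i, (τ i).head = s i) ∧ τ' = fun i => (τ i).write (s' i)
  | move d, τ, τ' => τ' = fun i => shift (d i) (τ i)

/-- The inverse instruction. -/
def inv : Instr ι Γ → Instr ι Γ
  | write s s' => write s' s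
  | move d => move fun i => flipDir (d i)

/-- Two rewriting instructions that are never applicable to the same tapes. -/
def Clash : Instr ι Γ → Instr ι Γ → Prop
  | write s _, write t _ => s ≠ t
  | _, _ => False

theorem inv_inv (i : Instr ι Γ) : i.inv.inv = i := by
  cases i <;> simp [inv, flipDir_flipDir]

theorem inv_injective : Function.Injective (inv : Instr ι Γ → Instr ι Γ) :=
  Function.LeftInverse.injective inv_inv

variable [Inhabited Γ] in
theorem Rel.symm {i : Instr ι Γ} {τ τ' : ι → Turing.Tape Γ} (h : i.Rel τ τ') :
    i.inv.Rel τ' τ := by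
  cases i with
  | write s s' =>
    obtain ⟨h, rfl⟩ := h
    refine ⟨fun i => rfl, ?_⟩
    funext i
    simp [Turing.Tape.write, ← h i]
  | move d =>
    obtain rfl := h
    simp only [inv, Rel, shift_flipDir]

variable [Inhabited Γ] in
theorem Rel.det {i : Instr ι Γ} {τ τ₁ τ₂ : ι → Turing.Tape Γ} (h₁ : i.Rel τ τ₁)
    (h₂ : i.Rel τ τ₂) : τ₁ = τ₂ := by
  cases i with
  | write s s' => exact h₁.2.trans h₂.2.symm
  | move d => exact Eq.trans h₁ (Eq.symm h₂)

variable [Inhabited Γ] in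
theorem Rel.not_clash {i j : Instr ι Γ} {τ τ₁ τ₂ : ι → Turing.Tape Γ} (h₁ : i.Rel τ τ₁)
    (h₂ : j.Rel τ τ₂) : ¬ i.Clash j := by
  cases i <;> cases j <;> simp only [Clash, not_false_eq_true, not_not, ne_eq]
  funext i
  rw [← h₁.1 i, h₂.1 i]

end Instr

/-- A reversible machine in quadruple form: a finite transition system, labelled by instructions,
that is deterministic in both directions. -/
structure RM (ι Γ : Type) [Inhabited Γ] : Type 1 where
  Q : Type
  finQ : Finite Q
  T : Q → Instr ι Γ → Q → Prop
  start : Q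
  halt : Q
  fwd : ∀ {q i a j b}, T q i a → T q j b → i.Clash j ∨ (i = j ∧ a = b)
  bwd : ∀ {q i a j b}, T a i q → T b j q → i.inv.Clash j.inv ∨ (i = j ∧ a = b)
  not_start : ∀ {q i}, ¬ T q i start
  not_halt : ∀ {q i}, ¬ T halt i q

namespace RM

variable {ι Γ : Type} [Inhabited Γ]

/-- One step of a machine in quadruple form. -/
def Step (M : RM ι Γ) (c c' : M.Q × (ι → Turing.Tape Γ)) : Prop :=
  ∃ i, M.T c.1 i c'.1 ∧ i.Rel c.2 c'.2

/-- The machine transforms the tapes `τ` into the tapes `τ'`. -/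
def Computes (M : RM ι Γ) (τ τ' : ι → Turing.Tape Γ) : Prop :=
  ReflTransGen M.Step (M.start, τ) (M.halt, τ')

theorem Step.det {M : RM ι Γ} {c c₁ c₂ : M.Q × (ι → Turing.Tape Γ)} (h₁ : M.Step c c₁)
    (h₂ : M.Step c c₂) : c₁ = c₂ := by
  obtain ⟨i, hi, ri⟩ := h₁
  obtain ⟨j, hj, rj⟩ := h₂
  rcases M.fwd hi hj with h | ⟨rfl, h⟩
  · exact absurd h (ri.not_clash rj)
  · exact Prod.ext h (ri.det rj)

theorem Step.codet {M : RM ι Γ} {c c₁ c₂ : M.Q × (ι → Turing.Tape Γ)} (h₁ : M.Step c₁ c)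
    (h₂ : M.Step c₂ c) : c₁ = c₂ := by
  obtain ⟨i, hi, ri⟩ := h₁
  obtain ⟨j, hj, rj⟩ := h₂
  rcases M.bwd hi hj with h | ⟨rfl, h⟩
  · exact absurd h (ri.symm.not_clash rj.symm)
  · exact Prod.ext h (ri.symm.det rj.symm)

/-- The inverse machine. -/
def inv (M : RM ι Γ) : RM ι Γ where
  Q := M.Q
  finQ := M.finQ
  T a i b := M.T b i.inv a
  start := M.halt
  halt := M.start
  fwd h₁ h₂ := by
    have := M.bwd h₁ h₂
    rwa [Instr.inv_inv, Instr.inv_inv, Instr.inv_injective.eq_iff] at this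
  bwd h₁ h₂ := by
    have := M.fwd h₁ h₂
    rwa [Instr.inv_injective.eq_iff] at this
  not_start := M.not_halt
  not_halt := M.not_start

theorem Computes.inv {M : RM ι Γ} {τ τ' : ι → Turing.Tape Γ} (h : M.Computes τ τ') :
    M.inv.Computes τ' τ := by
  refine ReflTransGen.mono (r := Function.swap M.Step) ?_ _ _ (ReflTransGen.swap _ _ h)
  rintro a b ⟨i, hi, r⟩
  exact ⟨i.inv, by simpa [RM.inv, Instr.inv_inv] using hi, r.symm⟩

/-- The transitions of the sequential composition. -/
inductive SeqT (M N : RM ι Γ) : M.Q ⊕ N.Q → Instr ι Γ → M.Q ⊕ N.Q → Prop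
  | left {a i b} : M.T a i b → SeqT M N (.inl a) i (.inl b)
  | right {a i b} : N.T a i b → SeqT M N (.inr a) i (.inr b)
  | link : SeqT M N (.inl M.halt) (.move fun _ => none) (.inr N.start)

/-- Sequential composition. -/
def seq (M N : RM ι Γ) : RM ι Γ where
  Q := M.Q ⊕ N.Q
  finQ := by
    have := M.finQ
    have := N.finQ
    infer_instance
  T := SeqT M N
  start := .inl M.start
  halt := .inr N.halt
  fwd := by
    rintro q i a j b (⟨h⟩ | ⟨h⟩ | _) h'
    · cases h' with
      | left h' => simpa using M.fwd h h'
      | link => exact absurd h M.not_halt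
    · cases h' with
      | right h' => simpa using N.fwd h h'
    · cases h' with
      | left h' => exact absurd h' M.not_halt
      | link => simp
  bwd := by
    rintro q i a j b (⟨h⟩ | ⟨h⟩ | _) h'
    · cases h' with
      | left h' => simpa using M.bwd h h'
    · cases h' with
      | right h' => simpa using N.bwd h h'
      | link => exact absurd h N.not_start
    · cases h' with
      | right h' => exact absurd h' N.not_start
      | link => simp
  not_start := by
    rintro q i ⟨h⟩
    exact M.not_start ‹_›
  not_halt := by
    rintro q i (_ | ⟨h⟩ | _)
    exact N.not_halt ‹_›

theorem Computes.seq {M N : RM ι Γ} {τ₁ τ₂ τ₃ : ι → Turing.Tape Γ} (h₁ : M.Computes τ₁ τ₂)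
    (h₂ : N.Computes τ₂ τ₃) : (M.seq N).Computes τ₁ τ₃ := by
  have e₁ : ReflTransGen (M.seq N).Step (.inl M.start, τ₁) (.inl M.halt, τ₂) :=
    ReflTransGen.lift (r := M.Step) (fun c => (Sum.inl c.1, c.2))
      (fun a b ⟨i, hi, r⟩ => ⟨i, SeqT.left hi, r⟩) _ _ h₁
  have e₂ : ReflTransGen (M.seq N).Step (.inr N.start, τ₂) (.inr N.halt, τ₃) :=
    ReflTransGen.lift (r := N.Step) (fun c => (Sum.inr c.1, c.2))
      (fun a b ⟨i, hi, r⟩ => ⟨i, SeqT.right hi, r⟩) _ _ h₂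
  have e : (M.seq N).Step (.inl M.halt, τ₂) (.inr N.start, τ₂) :=
    ⟨.move fun _ => none, SeqT.link, rfl⟩
  exact (e₁.tail e).trans e₂

/-! ### From quadruple form to Turing machines -/

variable {A : Type} {k : ℕ}

/-- The transition function of the Turing machine that executes `M`. -/
noncomputable def delta (M : RM (Fin (k + 1)) (Sym A)) (q : M.Q) (s : Fin (k + 1) → Sym A) :
    Option (Option M.Q × (Fin (k + 1) → Sym A × Option Turing.Dir)) :=
  open Classical in
  if q = M.halt then some (none, fun i => (s i, none))
  else if h : ∃ p : (Fin (k + 1) → Option Turing.Dir) × M.Q, M.T q (.move p.1) p.2 then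
    some (some h.choose.2, fun i => (s i, h.choose.1 i))
  else if h : ∃ p : (Fin (k + 1) → Sym A) × M.Q, M.T q (.write s p.1) p.2 then
    some (some h.choose.2, fun i => (h.choose.1 i, none))
  else none

/-- The Turing machine that executes a machine in quadruple form. -/
noncomputable abbrev toTM [Finite A] (M : RM (Fin (k + 1)) (Sym A)) : TM where
  Q := M.Q
  finQ := M.finQ
  A := A
  finA := inferInstance
  k := k
  start := M.start
  δ := M.delta

theorem act_head (T : Turing.Tape (Sym A)) (d : Option Turing.Dir) :
    act (T.head, d) T = shift d T := by
  rcases d with _ | d <;> rfl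

theorem delta_halt (M : RM (Fin (k + 1)) (Sym A)) (s : Fin (k + 1) → Sym A) :
    M.delta M.halt s = some (none, fun i => (s i, none)) := by
  simp [delta]

/-- The choice in `delta` is harmless: whatever is chosen is a transition of `M`, and `Step.det`
leaves only one possible result. -/
theorem step_of_delta (M : RM (Fin (k + 1)) (Sym A)) {q : M.Q} (hq : q ≠ M.halt)
    {τ : Fin (k + 1) → Turing.Tape (Sym A)} {p}
    (h : M.delta q (fun i => (τ i).head) = some p) :
    ∃ q', p.1 = some q' ∧ M.Step (q, τ) (q', fun i => act (p.2 i) (τ i)) := by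
  rw [delta, if_neg hq] at h
  split_ifs at h with h₁ h₂
  · obtain rfl := Option.some_injective _ h
    exact ⟨_, rfl, _, h₁.choose_spec, funext fun i => act_head _ _⟩
  · obtain rfl := Option.some_injective _ h
    exact ⟨_, rfl, _, h₂.choose_spec, fun i => rfl, rfl⟩

theorem delta_isSome (M : RM (Fin (k + 1)) (Sym A)) {q q' : M.Q}
    {τ τ' : Fin (k + 1) → Turing.Tape (Sym A)} (h : M.Step (q, τ) (q', τ')) :
    ∃ p, M.delta q (fun i => (τ i).head) = some p := by
  rw [delta]
  split_ifs with h₀ h₁ h₂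
  · exact ⟨_, rfl⟩
  · exact ⟨_, rfl⟩
  · exact ⟨_, rfl⟩
  · obtain ⟨i, hi, r⟩ := h
    cases i with
    | move d => exact absurd ⟨(d, q'), hi⟩ h₁
    | write s s' =>
      obtain ⟨r, -⟩ := r
      obtain rfl : (fun i => (τ i).head) = s := funext r
      exact absurd ⟨(s', q'), hi⟩ h₂

variable [Finite A] (M : RM (Fin (k + 1)) (Sym A))

theorem toTM_step_halt (τ : Fin (k + 1) → Turing.Tape (Sym A)) :
    M.toTM.step ⟨some M.halt, τ⟩ = some ⟨none, τ⟩ := by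
  simp only [TM.step, delta_halt]
  rfl

theorem toTM_step_cases {c c' : Cfg M.toTM} (h : M.toTM.step c = some c') :
    (c.state = some M.halt ∧ c' = ⟨none, c.tape⟩) ∨
      ∃ q q', c.state = some q ∧ c'.state = some q' ∧ M.Step (q, c.tape) (q', c'.tape) := by
  obtain ⟨_ | q, τ⟩ := c
  · simp [TM.step] at h
  by_cases hq : q = M.halt
  · subst hq
    exact .inl ⟨rfl, Option.some_injective _ (h.symm.trans (M.toTM_step_halt τ))⟩
  right
  simp only [TM.step] at h
  split at h
  · simp at h
  rename_i q' a heq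
  obtain rfl := Option.some_injective _ h
  obtain ⟨p, hp, hs⟩ := M.step_of_delta hq heq
  exact ⟨q, p, rfl, hp, hs⟩

theorem toTM_step_of_step {q q' : M.Q} {τ τ' : Fin (k + 1) → Turing.Tape (Sym A)}
    (h : M.Step (q, τ) (q', τ')) : M.toTM.step ⟨some q, τ⟩ = some ⟨some q', τ'⟩ := by
  have hq : q ≠ M.halt := by
    rintro rfl
    obtain ⟨i, hi, -⟩ := h
    exact M.not_halt hi
  obtain ⟨p, hp⟩ := M.delta_isSome h
  obtain ⟨q₁, h₁, hs⟩ := M.step_of_delta hq hp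
  have := hs.det h
  simp only [Prod.mk.injEq] at this
  obtain ⟨rfl, rfl⟩ := this
  simp only [TM.step, hp, h₁]

/-- The halting state `none` is entered only from `M.halt`, by a step that leaves the tapes alone.
Every other step is a step of `M`, where backward determinism is built in. -/
theorem toTM_reversible : M.toTM.Reversible := by
  refine ⟨fun c₁ c₂ c h₁ h₂ => ?_, fun c₁ c h hs => ?_⟩
  · rcases M.toTM_step_cases h₁ with ⟨e₁, r₁⟩ | ⟨a, b, ha, hb, hs⟩ <;>
      rcases M.toTM_step_cases h₂ with ⟨e₂, r₂⟩ | ⟨a', b', ha', hb', hs'⟩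
    · exact Cfg.ext (e₁.trans e₂.symm) (Cfg.mk.inj (r₁.symm.trans r₂)).2
    · rw [r₁] at hb'
      cases hb'
    · rw [r₂] at hb
      cases hb
    · obtain rfl : b = b' := Option.some_injective _ (hb.symm.trans hb')
      have := hs.codet hs'
      simp only [Prod.mk.injEq] at this
      exact Cfg.ext (by rw [ha, ha', this.1]) this.2
  · rcases M.toTM_step_cases h with ⟨-, rfl⟩ | ⟨a, b, ha, hb, i, hi, -⟩
    · cases hs
    · obtain rfl : b = M.start := Option.some_injective _ (hb.symm.trans hs)
      exact M.not_start hi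

theorem run_of_reflTransGen {q : M.Q} {τ τ' : Fin (k + 1) → Turing.Tape (Sym A)}
    (h : ReflTransGen M.Step (q, τ) (M.halt, τ')) :
    ∃ m, M.toTM.run m ⟨some q, τ⟩ = some ⟨none, τ'⟩ := by
  generalize hc : (q, τ) = c at h
  induction h using ReflTransGen.head_induction_on generalizing q τ with
  | refl =>
    cases hc
    exact ⟨1, by simp only [TM.run]; rw [M.toTM_step_halt]; rfl⟩
  | head h _ ih =>
    subst hc
    obtain ⟨m, hm⟩ := ih rfl
    exact ⟨m + 1, by simp only [TM.run, M.toTM_step_of_step h]; exact hm⟩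

end RM

/-! ### Reversible simulation with a history -/

/-- A deterministic machine that works on one tape at a time: in state `s` it moves the head of
the tape `tp s` as `pre s` says, then reads the scanned symbol `γ`, and
`act s γ = (γ', d, s')` tells it to write `γ'`, move as `d` says and enter state `s'`.
The tapes `h₁`, `h₂` are reserved for a history of the computation. -/
structure LM (ι Γ : Type) : Type 1 where
  S : Type
  finS : Finite S
  tp : S → ι
  pre : S → Option Turing.Dir
  act : S → Γ → Γ × Option Turing.Dir × S
  start : S
  halt : S
  act_ne_start : ∀ s γ, (act s γ).2.2 ≠ start
  h₁ : ι
  h₂ : ι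
  h₁_ne_h₂ : h₁ ≠ h₂
  tp_ne_h₁ : ∀ s, tp s ≠ h₁
  tp_ne_h₂ : ∀ s, tp s ≠ h₂
  enc : S → Γ
  enc_injective : Injective enc

namespace LM

variable {ι Γ : Type} [Inhabited Γ]

/-- The tape after its head has been moved by `d`, `γ` has been written, and the head has been
moved by `d'`. -/
def upd (d : Option Turing.Dir) (γ : Γ) (d' : Option Turing.Dir) (T : Turing.Tape Γ) :
    Turing.Tape Γ :=
  shift d' ((shift d T).write γ)

variable [DecidableEq ι] (N : LM ι Γ)

/-- The symbol that is read next. -/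
def sym (s : N.S) (τ : ι → Turing.Tape Γ) : Γ := (shift (N.pre s) (τ (N.tp s))).head

/-- The tapes after the next step. -/
def nextTape (s : N.S) (τ : ι → Turing.Tape Γ) : ι → Turing.Tape Γ :=
  update τ (N.tp s) (upd (N.pre s) (N.act s (N.sym s τ)).1 (N.act s (N.sym s τ)).2.1 (τ (N.tp s)))

/-- One step of computation. -/
def Step (c c' : N.S × (ι → Turing.Tape Γ)) : Prop :=
  c.1 ≠ N.halt ∧ c' = ((N.act c.1 (N.sym c.1 c.2)).2.2, N.nextTape c.1 c.2)

/-- The control states of the machine that keeps a history. -/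
inductive LogQ (N : LM ι Γ) : Type
  | rest (s : N.S)
  | read (s : N.S)
  | wrote (s : N.S) (γ : Γ)
  | log (s : N.S) (γ : Γ)

omit [DecidableEq ι] in
theorem finite_logQ [Finite Γ] : Finite (LogQ N) := by
  have := N.finS
  let f : LogQ N → Fin 4 × N.S × Γ
    | .rest s => (0, s, default)
    | .read s => (1, s, default)
    | .wrote s γ => (2, s, γ)
    | .log s γ => (3, s, γ)
  refine Finite.of_injective f ?_
  rintro (s | s | ⟨s, γ⟩ | ⟨s, γ⟩) (t | t | ⟨t, δ⟩ | ⟨t, δ⟩) <;> simp [f]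

/-- The transitions of the machine that keeps a history. -/
inductive LogT : LogQ N → Instr ι Γ → LogQ N → Prop
  | pre (s) : s ≠ N.halt → LogT (.rest s)
      (.move fun i => if i = N.tp s then N.pre s
        else if i = N.h₁ ∨ i = N.h₂ then some .right else none) (.read s)
  | act (s v) : LogT (.read s) (.write v (update v (N.tp s) (N.act s (v (N.tp s))).1))
      (.wrote s (v (N.tp s)))
  | post (s γ) : LogT (.wrote s γ) (.move (update (fun _ => none) (N.tp s) (N.act s γ).2.1))
      (.log s γ)
  | log (s γ v) : v N.h₁ = default → v N.h₂ = default → LogT (.log s γ)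
      (.write v (update (update v N.h₁ γ) N.h₂ (N.enc s))) (.rest (N.act s γ).2.2)

/-- The reversible machine that executes `N` and keeps a history. -/
def logger [Finite Γ] : RM ι Γ where
  Q := LogQ N
  finQ := N.finite_logQ
  T := LogT N
  start := .rest N.start
  halt := .rest N.halt
  fwd := by
    rintro q i a j b (h | ⟨s, v⟩ | _ | ⟨s, γ, v, -, -⟩) (h' | ⟨-, v'⟩ | _ | ⟨-, -, v', -, -⟩)
    · simp
    · by_cases e : v = v'
      · subst e
        simp
      · exact .inl e
    · simp
    · by_cases e : v = v'
      · subst e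
        simp
      · exact .inl e
  bwd := by
    rintro q i a j b h h'
    rw [or_iff_not_imp_left]
    intro hc
    cases h with
    | pre s hs => cases h'; simp
    -- The overwritten symbol is remembered by the state `wrote s γ`, and all other tapes are
    -- unchanged.
    | act s v =>
      generalize hγ : v (N.tp s) = γ at h'
      cases h' with
      | act _ v' =>
        have e := not_not.1 hc
        have : v = v' := by
          funext i
          by_cases hi : i = N.tp s
          · rw [hi, hγ]
          · simpa [hi] using congrFun e i
        subst this
        simp
    | post s γ => cases h'; simp
    -- Different pairs `(s, γ)` may lead to the same next state, but the record just written shows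
    -- which one it was. The squares of the record are required to have been blank before, so the
    -- old symbols there are known too.
    | log s γ v h₁ h₂ =>
      generalize hq : (N.act s γ).2.2 = q at h'
      cases h' with
      | log s' γ' v' h₁' h₂' =>
        have e := not_not.1 hc
        have e₂ : s = s' := N.enc_injective (by simpa using congrFun e N.h₂)
        have e₁ : γ = γ' := by simpa [N.h₁_ne_h₂] using congrFun e N.h₁
        have : v = v' := by
          funext i
          by_cases hi₁ : i = N.h₁
          · rw [hi₁, h₁, h₁']
          by_cases hi₂ : i = N.h₂
          · rw [hi₂, h₂, h₂']
          simpa [hi₁, hi₂] using congrFun e i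
        subst e₁ e₂ this
        simp
  not_start := by
    rintro q i h
    generalize hq : LogQ.rest N.start = q' at h
    cases h with
    | log s γ v => exact N.act_ne_start _ _ (LogQ.rest.inj hq).symm
    | _ => cases hq
  not_halt := by
    rintro q i h
    cases h with
    | pre s hs => exact hs rfl

/-- The tapes after one step and its record in the history. -/
def logTape (s : N.S) (τ : ι → Turing.Tape Γ) : ι → Turing.Tape Γ := fun i =>
  if i = N.h₁ then upd (some .right) (N.sym s τ) none (τ i)
  else if i = N.h₂ then upd (some .right) (N.enc s) none (τ i)
  else N.nextTape s τ i

/-- Each record goes one square to the right of the previous one. Blankness to the right of both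
history heads guarantees fresh squares, and `upd_right` shows that it persists. -/
theorem logger_step [Finite Γ] {s : N.S} (hs : s ≠ N.halt) {τ : ι → Turing.Tape Γ}
    (h₁ : (τ N.h₁).right = Turing.ListBlank.mk []) (h₂ : (τ N.h₂).right = Turing.ListBlank.mk []) :
    ReflTransGen N.logger.Step (LogQ.rest s, τ)
      (LogQ.rest (N.act s (N.sym s τ)).2.2, N.logTape s τ) := by
  have n₁ := N.tp_ne_h₁ s
  have n₂ := N.tp_ne_h₂ s
  have n := N.h₁_ne_h₂
  obtain ⟨τ₁, hτ₁⟩ : ∃ τ₁ : ι → Turing.Tape Γ, τ₁ = fun i => shift (if i = N.tp s then N.pre s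
      else if i = N.h₁ ∨ i = N.h₂ then some .right else none) (τ i) := ⟨_, rfl⟩
  have hγ : (τ₁ (N.tp s)).head = N.sym s τ := by simp [hτ₁, sym]
  obtain ⟨γ, hγ'⟩ : ∃ γ, γ = N.sym s τ := ⟨_, rfl⟩
  obtain ⟨τ₂, hτ₂⟩ : ∃ τ₂ : ι → Turing.Tape Γ, τ₂ = fun i => (τ₁ i).write
      (update (fun i => (τ₁ i).head) (N.tp s) (N.act s γ).1 i) := ⟨_, rfl⟩
  obtain ⟨τ₃, hτ₃⟩ : ∃ τ₃ : ι → Turing.Tape Γ, τ₃ = fun i => shift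
      (update (fun _ => none) (N.tp s) (N.act s γ).2.1 i) (τ₂ i) := ⟨_, rfl⟩
  have b : ∀ T : Turing.Tape Γ, T.right = Turing.ListBlank.mk [] →
      (T.move .right).head = default := by
    rintro ⟨a, l, r⟩ h
    obtain rfl : r = _ := h
    rfl
  have e₁ : τ₃ N.h₁ = (τ N.h₁).move .right := by
    simp [hτ₃, hτ₂, hτ₁, n₁.symm, shift]
  have e₂ : τ₃ N.h₂ = (τ N.h₂).move .right := by
    simp [hτ₃, hτ₂, hτ₁, n₂.symm, shift]
  have e₃ : τ₃ (N.tp s) = N.nextTape s τ (N.tp s) := by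
    simp [hτ₃, hτ₂, hτ₁, nextTape, upd, hγ']
  have e₄ : ∀ i, i ≠ N.h₁ → i ≠ N.h₂ → i ≠ N.tp s → τ₃ i = N.nextTape s τ i := by
    intro i i₁ i₂ i₃
    simp [hτ₃, hτ₂, hτ₁, i₁, i₂, i₃, shift, nextTape]
  have s₁ : N.logger.Step (LogQ.rest s, τ) (LogQ.read s, τ₁) := ⟨_, .pre s hs, hτ₁⟩
  have s₂ : N.logger.Step (LogQ.read s, τ₁) (LogQ.wrote s γ, τ₂) := by
    refine ⟨.write (fun i => (τ₁ i).head)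
      (update (fun i => (τ₁ i).head) (N.tp s) (N.act s γ).1), ?_, fun i => rfl, hτ₂⟩
    have := LogT.act (N := N) s fun i => (τ₁ i).head
    rwa [hγ, ← hγ'] at this
  have s₃ : N.logger.Step (LogQ.wrote s γ, τ₂) (LogQ.log s γ, τ₃) := ⟨_, .post s γ, hτ₃⟩
  have s₄ : N.logger.Step (LogQ.log s γ, τ₃) (LogQ.rest (N.act s γ).2.2, N.logTape s τ) := by
    refine ⟨_, .log s γ (fun i => (τ₃ i).head) ?_ ?_, fun i => rfl, ?_⟩
    · rw [e₁, b _ h₁]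
    · rw [e₂, b _ h₂]
    funext i
    by_cases i₁ : i = N.h₁
    · subst i₁
      simp [logTape, upd, shift, e₁, hγ', n]
    by_cases i₂ : i = N.h₂
    · subst i₂
      simp [logTape, upd, shift, e₂, n.symm]
    by_cases i₃ : i = N.tp s
    · subst i₃
      simp [logTape, e₃, i₁, i₂]
    · simp [logTape, e₄ i i₁ i₂ i₃, i₁, i₂]
  rw [← hγ']
  exact .head s₁ (.head s₂ (.head s₃ (.single s₄)))

theorem upd_right (γ : Γ) {T : Turing.Tape Γ} (h : T.right = Turing.ListBlank.mk []) :
    (upd (some .right) γ none T).right = Turing.ListBlank.mk [] := by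
  obtain ⟨a, l, r⟩ := T
  obtain rfl : r = _ := h
  rfl

/-- The machine that keeps a history simulates `N`, uniformly in the contents of a tape `c` that
`N` does not use. -/
theorem logger_reaches [Finite Γ] {c : ι} (hc : ∀ s, N.tp s ≠ c) (hc₁ : c ≠ N.h₁) (hc₂ : c ≠ N.h₂)
    {s s' : N.S} {τ τ' : ι → Turing.Tape Γ} (h : ReflTransGen N.Step (s, τ) (s', τ'))
    {σ : ι → Turing.Tape Γ} (hσ : ∀ i, i ≠ N.h₁ → i ≠ N.h₂ → σ i = τ i)
    (h₁ : (σ N.h₁).right = Turing.ListBlank.mk []) (h₂ : (σ N.h₂).right = Turing.ListBlank.mk []) :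
    ∃ σ', (∀ i, i ≠ N.h₁ → i ≠ N.h₂ → σ' i = τ' i) ∧
      ∀ X, ReflTransGen N.logger.Step (LogQ.rest s, update σ c X)
        (LogQ.rest s', update σ' c X) := by
  generalize hp : (s, τ) = p at h
  induction h using ReflTransGen.head_induction_on generalizing s τ σ with
  | refl =>
    cases hp
    exact ⟨σ, hσ, fun X => .refl⟩
  | @head a b hab _ ih =>
    subst hp
    obtain ⟨hs, rfl⟩ := hab
    have hsym : N.sym s σ = N.sym s τ := by
      rw [sym, sym, hσ _ (N.tp_ne_h₁ s) (N.tp_ne_h₂ s)]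
    obtain ⟨σ', hσ', hr⟩ := ih (s := (N.act s (N.sym s τ)).2.2) (τ := N.nextTape s τ)
      (σ := N.logTape s σ)
      (fun i i₁ i₂ => by
        simp only [logTape, i₁, i₂, if_false, nextTape, hsym, hσ _ (N.tp_ne_h₁ s) (N.tp_ne_h₂ s)]
        by_cases hi : i = N.tp s
        · subst hi
          simp
        · simp [hi, hσ i i₁ i₂])
      (by simp [logTape, upd_right, h₁])
      (by simp [logTape, upd_right, h₂, N.h₁_ne_h₂.symm]) rfl
    refine ⟨σ', hσ', fun X => .trans ?_ (hr X)⟩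
    have := N.logger_step hs (τ := update σ c X) (by simpa [hc₁.symm] using h₁)
      (by simpa [hc₂.symm] using h₂)
    have hsym' : N.sym s (update σ c X) = N.sym s τ := by
      rw [← hsym, sym, sym, update_of_ne (hc s)]
    rw [hsym'] at this
    convert! this using 2
    funext i
    by_cases hi : i = c
    · subst hi
      simp [logTape, hc₁, hc₂, nextTape, (hc s).symm]
    · simp only [update_of_ne hi, logTape, hsym', hsym, nextTape, update_of_ne (hc s)]
      by_cases hi' : i = N.tp s
      · subst hi'
        simp
      · simp [hi', hi]

end LM

/-! ### Reversible copying of a word -/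

theorem Tape.move_right_mk₂ {Γ : Type} [Inhabited Γ] (a : Γ) (l r : List Γ) :
    (Turing.Tape.mk₂ l (a :: r)).move .right = Turing.Tape.mk₂ (a :: l) r := by
  simp only [Turing.Tape.mk₂, Turing.Tape.move_right_mk']
  rfl

theorem Tape.move_left_mk₂ {Γ : Type} [Inhabited Γ] (a : Γ) (l r : List Γ) :
    (Turing.Tape.mk₂ (a :: l) r).move .left = Turing.Tape.mk₂ l (a :: r) := by
  simp only [Turing.Tape.mk₂, Turing.Tape.move_left_mk']
  rfl

theorem Tape.move_left_mk₂_nil {Γ : Type} [Inhabited Γ] (r : List Γ) :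
    (Turing.Tape.mk₂ [] r).move .left = Turing.Tape.mk₂ [] (default :: r) := by
  simp only [Turing.Tape.mk₂, Turing.Tape.move_left_mk']
  rfl

/-- The control states of the copying machine. -/
inductive CopyQ
  | start | enter | right | read | left | back | exit | halt

instance : Finite CopyQ :=
  Finite.of_surjective (fun n : Fin 8 =>
    ![CopyQ.start, .enter, .right, .read, .left, .back, .exit, .halt] n) <| by
    rintro (_ | _ | _ | _ | _ | _ | _ | _)
    exacts [⟨0, rfl⟩, ⟨1, rfl⟩, ⟨2, rfl⟩, ⟨3, rfl⟩, ⟨4, rfl⟩, ⟨5, rfl⟩, ⟨6, rfl⟩, ⟨7, rfl⟩]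

section Copying

variable {ι Γ : Type} [Inhabited Γ] [DecidableEq ι]

/-- The transitions of the copying machine. -/
inductive CopyT (i j : ι) : CopyQ → Instr ι Γ → CopyQ → Prop
  | start : CopyT i j .start (.move fun k => if k = i ∨ k = j then some .left else none) .enter
  -- The loop state `right` has two entrances, `enter` and `copy`. Backwards they are told apart by
  -- whether tape `i` shows a blank, which is why the sweep begins on the blank to the left of the
  -- word. The entrances `turn` and `back` of `left` are separated in the same way.
  | enter (v) : v i = default → v j = default → CopyT i j .enter (.write v v) .right
  | right : CopyT i j .right (.move fun k => if k = i ∨ k = j then some .right else none) .read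
  | copy (v) : v i ≠ default → v j = default →
      CopyT i j .read (.write v (update v j (v i))) .right
  | turn (v) : v i = default → v j = default → CopyT i j .read (.write v v) .left
  | left : CopyT i j .left (.move fun k => if k = i ∨ k = j then some .left else none) .back
  | back (v) : v i ≠ default → v j = v i → CopyT i j .back (.write v v) .left
  | exit (v) : v i = default → v j = default → CopyT i j .back (.write v v) .exit
  | halt : CopyT i j .exit (.move fun k => if k = i ∨ k = j then some .right else none) .halt

/-- The reversible machine that copies a word from tape `i` to the empty tape `j`. -/
def copier {i j : ι} (hij : i ≠ j) : RM ι Γ where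
  Q := CopyQ
  finQ := inferInstance
  T := CopyT i j
  start := .start
  halt := .halt
  fwd := by
    rintro q a q₁ b q₂ h h'
    rw [or_iff_not_imp_left]
    intro hc
    cases h <;> cases h' <;> simp only [Instr.Clash, not_not] at hc <;>
      first
        | exact ⟨rfl, rfl⟩
        | (subst hc; first | exact ⟨rfl, rfl⟩ | contradiction)
  bwd := by
    rintro q a q₁ b q₂ h h'
    rw [or_iff_not_imp_left]
    intro hc
    cases h <;> cases h' <;> simp only [Instr.inv, Instr.Clash, not_not] at hc <;>
      first
        | exact ⟨rfl, rfl⟩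
        | (subst hc; first | exact ⟨rfl, rfl⟩ | contradiction | simp_all)
        | skip
    -- What remains is `copy` against `copy`: the only symbol overwritten is the one on tape `j`,
    -- and it was blank.
    rename_i v h₁ h₂ v' h₁' h₂'
    have : v = v' := by
      funext k
      by_cases hk : k = j
      · rw [hk, h₂, h₂']
      · simpa [hk] using congrFun hc k
    subst this
    exact ⟨rfl, rfl⟩
  not_start := by rintro q i ⟨⟩
  not_halt := by rintro q i ⟨⟩

section

variable {i j : ι} (hij : i ≠ j) (τ : ι → Turing.Tape Γ)

/-- The tapes `τ` with the contents of the tapes `i` and `j` replaced. -/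
def setPair (i j : ι) (τ : ι → Turing.Tape Γ) (T T' : Turing.Tape Γ) : ι → Turing.Tape Γ :=
  update (update τ i T) j T'

include hij in
theorem shift_setPair (d : Turing.Dir) (T T' : Turing.Tape Γ) :
    setPair i j τ (T.move d) (T'.move d) =
      fun k => shift (if k = i ∨ k = j then some d else none) (setPair i j τ T T' k) := by
  funext k
  by_cases h₁ : k = j
  · subst h₁
    simp [setPair, shift]
  by_cases h₂ : k = i
  · subst h₂
    simp [setPair, shift, hij]
  · simp [setPair, shift, h₁, h₂]

include hij in
theorem setPair_left (T T' : Turing.Tape Γ) : setPair i j τ T T' i = T := by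
  simp [setPair, hij]

theorem setPair_right (T T' : Turing.Tape Γ) : setPair i j τ T T' j = T' := by
  simp [setPair]

omit [DecidableEq ι] in
theorem write_heads (σ : ι → Turing.Tape Γ) : (fun k => (σ k).write (σ k).head) = σ := by
  simp [Turing.Tape.write_self]

/-- Loop invariant of the sweep to the right: the reversal of `l` is already copied, and `r`
remains. -/
theorem copier_read (r l : List Γ) (hr : ∀ γ ∈ r, γ ≠ default) :
    ReflTransGen (copier hij).Step
      (CopyQ.read, setPair i j τ (Turing.Tape.mk₂ l r) (Turing.Tape.mk₂ l []))
      (CopyQ.left, setPair i j τ (Turing.Tape.mk₂ (r.reverse ++ l) [])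
        (Turing.Tape.mk₂ (r.reverse ++ l) [])) := by
  induction r generalizing l with
  | nil =>
    refine .single ⟨_, CopyT.turn (fun k => (setPair i j τ _ _ k).head) ?_ ?_, fun k => rfl,
      (write_heads _).symm⟩
    · rw [setPair_left hij]
      rfl
    · rw [setPair_right]
      rfl
  | cons γ r ih =>
    have s₁ : (copier hij).Step
        (CopyQ.read, setPair i j τ (Turing.Tape.mk₂ l (γ :: r)) (Turing.Tape.mk₂ l []))
        (CopyQ.right, setPair i j τ (Turing.Tape.mk₂ l (γ :: r)) (Turing.Tape.mk₂ l [γ])) := by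
      refine ⟨_, CopyT.copy (fun k => (setPair i j τ _ _ k).head) ?_ ?_, fun k => rfl, ?_⟩
      · rw [setPair_left hij]
        exact hr γ (by simp)
      · rw [setPair_right]
        rfl
      · funext k
        by_cases h : k = j
        · subst h
          simp only [update_self, setPair_left hij]
          simp only [setPair_right]
          rfl
        · simp only [update_of_ne h, Turing.Tape.write_self]
          simp [setPair, h]
    have s₂ : (copier hij).Step
        (CopyQ.right, setPair i j τ (Turing.Tape.mk₂ l (γ :: r)) (Turing.Tape.mk₂ l [γ]))
        (CopyQ.read, setPair i j τ (Turing.Tape.mk₂ (γ :: l) r) (Turing.Tape.mk₂ (γ :: l) [])) := by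
      refine ⟨_, CopyT.right, ?_⟩
      rw [← Tape.move_right_mk₂, ← Tape.move_right_mk₂]
      exact shift_setPair hij τ .right _ _
    refine .head s₁ (.head s₂ ?_)
    simpa using ih (γ :: l) fun a ha => hr a (by simp [ha])

theorem copier_left (l r : List Γ) (hl : ∀ γ ∈ l, γ ≠ default) :
    ReflTransGen (copier hij).Step
      (CopyQ.left, setPair i j τ (Turing.Tape.mk₂ l r) (Turing.Tape.mk₂ l r))
      (CopyQ.halt, setPair i j τ (Turing.Tape.mk₁ (l.reverse ++ r))
        (Turing.Tape.mk₁ (l.reverse ++ r))) := by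
  induction l generalizing r with
  | nil =>
    have s₁ : (copier hij).Step
        (CopyQ.left, setPair i j τ (Turing.Tape.mk₂ [] r) (Turing.Tape.mk₂ [] r))
        (CopyQ.back, setPair i j τ (Turing.Tape.mk₂ [] (default :: r))
          (Turing.Tape.mk₂ [] (default :: r))) := by
      refine ⟨_, CopyT.left, ?_⟩
      rw [← Tape.move_left_mk₂_nil]
      exact shift_setPair hij τ .left _ _
    have s₂ : (copier hij).Step
        (CopyQ.back, setPair i j τ (Turing.Tape.mk₂ [] (default :: r))
          (Turing.Tape.mk₂ [] (default :: r)))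
        (CopyQ.exit, setPair i j τ (Turing.Tape.mk₂ [] (default :: r))
          (Turing.Tape.mk₂ [] (default :: r))) := by
      refine ⟨_, CopyT.exit (fun k => (setPair i j τ _ _ k).head) ?_ ?_, fun k => rfl,
        (write_heads _).symm⟩
      · rw [setPair_left hij]
        rfl
      · rw [setPair_right]
        rfl
    refine .head s₁ (.head s₂ (.single ⟨_, CopyT.halt, ?_⟩))
    rw [← Tape.move_left_mk₂_nil]
    simpa [Turing.Tape.mk₁, Instr.Rel] using
      shift_setPair hij τ .right ((Turing.Tape.mk₂ [] r).move .left)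
        ((Turing.Tape.mk₂ [] r).move .left)
  | cons γ l ih =>
    have s₁ : (copier hij).Step
        (CopyQ.left, setPair i j τ (Turing.Tape.mk₂ (γ :: l) r) (Turing.Tape.mk₂ (γ :: l) r))
        (CopyQ.back, setPair i j τ (Turing.Tape.mk₂ l (γ :: r))
          (Turing.Tape.mk₂ l (γ :: r))) := by
      refine ⟨_, CopyT.left, ?_⟩
      rw [← Tape.move_left_mk₂]
      exact shift_setPair hij τ .left _ _
    have s₂ : (copier hij).Step
        (CopyQ.back, setPair i j τ (Turing.Tape.mk₂ l (γ :: r)) (Turing.Tape.mk₂ l (γ :: r)))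
        (CopyQ.left, setPair i j τ (Turing.Tape.mk₂ l (γ :: r)) (Turing.Tape.mk₂ l (γ :: r))) := by
      refine ⟨_, CopyT.back (fun k => (setPair i j τ _ _ k).head) ?_ ?_, fun k => rfl,
        (write_heads _).symm⟩
      · rw [setPair_left hij]
        exact hl γ (by simp)
      · rw [setPair_left hij, setPair_right]
    refine .head s₁ (.head s₂ ?_)
    simpa using ih (γ :: r) fun a ha => hl a (by simp [ha])

theorem copier_computes (w : List Γ) (hw : ∀ γ ∈ w, γ ≠ default)
    (hi : τ i = Turing.Tape.mk₁ w) (hj : τ j = Turing.Tape.mk₁ []) :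
    (copier hij).Computes τ (update τ j (Turing.Tape.mk₁ w)) := by
  have hτ : τ = setPair i j τ (Turing.Tape.mk₂ [] w) (Turing.Tape.mk₂ [] []) := by
    rw [setPair, ← Turing.Tape.mk₁, ← Turing.Tape.mk₁, ← hi, ← hj]
    simp
  have s₁ : (copier hij).Step
      (CopyQ.start, setPair i j τ (Turing.Tape.mk₂ [] w) (Turing.Tape.mk₂ [] []))
      (CopyQ.enter, setPair i j τ (Turing.Tape.mk₂ [] (default :: w))
        (Turing.Tape.mk₂ [] [default])) := by
    refine ⟨_, CopyT.start, ?_⟩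
    rw [← Tape.move_left_mk₂_nil, ← Tape.move_left_mk₂_nil]
    exact shift_setPair hij τ .left _ _
  have s₂ : (copier hij).Step
      (CopyQ.enter, setPair i j τ (Turing.Tape.mk₂ [] (default :: w))
        (Turing.Tape.mk₂ [] [default]))
      (CopyQ.right, setPair i j τ (Turing.Tape.mk₂ [] (default :: w))
        (Turing.Tape.mk₂ [] [default])) := by
    refine ⟨_, CopyT.enter (fun k => (setPair i j τ _ _ k).head) ?_ ?_, fun k => rfl,
      (write_heads _).symm⟩
    · rw [setPair_left hij]
      rfl
    · rw [setPair_right]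
      rfl
  have s₃ : (copier hij).Step
      (CopyQ.right, setPair i j τ (Turing.Tape.mk₂ [] (default :: w))
        (Turing.Tape.mk₂ [] [default]))
      (CopyQ.read, setPair i j τ (Turing.Tape.mk₂ [] w) (Turing.Tape.mk₂ [] [])) := by
    refine ⟨_, CopyT.right, ?_⟩
    rw [← Tape.move_left_mk₂_nil, ← Tape.move_left_mk₂_nil]
    simpa [Instr.Rel] using shift_setPair hij τ .right ((Turing.Tape.mk₂ [] w).move .left)
      ((Turing.Tape.mk₂ [] []).move .left)
  have s₄ := copier_read hij τ w [] hw
  have s₅ := copier_left hij τ (w.reverse ++ []) [] (by simpa using hw)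
  have : update τ j (Turing.Tape.mk₁ w) =
      setPair i j τ (Turing.Tape.mk₁ w) (Turing.Tape.mk₁ w) := by
    rw [setPair, ← hi, update_eq_self]
  rw [this, RM.Computes]
  nth_rw 1 [hτ]
  simp only [List.append_nil, List.reverse_reverse] at s₄ s₅
  exact .head s₁ (.head s₂ (.head s₃ (s₄.trans s₅)))

end

end Copying

/-! ### Evaluating partial recursive codes on tapes -/

open Turing.PartrecToTM2 (Γ' K' Λ' Cont')

/-- The natural number with binary expansion `1w`. -/
def posNum (w : List Bool) : PosNum :=
  w.foldl (fun n b => PosNum.bit b n) 1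

/-- A number for each binary word `w`, namely the one with binary expansion `1w`. -/
def num (w : List Bool) : ℕ := posNum w

section Symbols

variable {H : Type}

/-- The tape symbols for the stack alphabet. -/
def ofΓ' : Γ' → Sym (Γ' ⊕ H)
  | .bit0 => .bit false
  | .bit1 => .bit true
  | γ => .aux (.inl γ)

/-- The stack symbol that is represented by a tape symbol. -/
def toΓ' : Sym (Γ' ⊕ H) → Option Γ'
  | .bit false => some .bit0
  | .bit true => some .bit1
  | .aux (.inl γ) => some γ
  | _ => none

/-- The stack symbol of a bit. -/
def bitΓ' (b : Bool) : Γ' := if b then .bit1 else .bit0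

theorem ofΓ'_bitΓ' (b : Bool) : (ofΓ' (bitΓ' b) : Sym (Γ' ⊕ H)) = .bit b := by
  cases b <;> rfl

theorem toΓ'_ofΓ' (γ : Γ') : toΓ' (ofΓ' γ : Sym (Γ' ⊕ H)) = some γ := by
  cases γ <;> rfl

theorem toΓ'_headI (L : List Γ') : toΓ' ((L.map ofΓ').headI : Sym (Γ' ⊕ H)) = L.head? := by
  cases L with
  | nil => rfl
  | cons a L => exact toΓ'_ofΓ' a

/-- `trNat` lists binary digits from the least significant one, so the extra leading `1` of `num`
comes last. -/
theorem trNat_num (w : List Bool) :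
    Turing.PartrecToTM2.trNat (num w) = (w.reverse.map bitΓ') ++ [.bit1] := by
  have : Turing.PartrecToTM2.trNat (num w) = Turing.PartrecToTM2.trPosNum (posNum w) := by
    rw [Turing.PartrecToTM2.trNat, num]
    have : (((posNum w : PosNum) : ℕ) : Num) = Num.pos (posNum w) :=
      PosNum.of_to_nat (posNum w)
    rw [this]
    rfl
  rw [this]
  clear this
  induction w using List.reverseRecOn with
  | nil => rfl
  | append_singleton w b ih =>
    have : posNum (w ++ [b]) = PosNum.bit b (posNum w) := by simp [posNum]
    rw [this]
    cases b <;> simp [PosNum.bit, Turing.PartrecToTM2.trPosNum, ih, bitΓ']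

end Symbols

section Stack

variable {Γ : Type} [Inhabited Γ]

/-- A tape that holds a stack, with the head on the top element. -/
def stackTape (L : List Γ) : Turing.Tape Γ :=
  ⟨L.headI, Turing.ListBlank.mk L.tail, Turing.ListBlank.mk []⟩

/-- Pushing onto an empty stack leaves a blank below the new top; `ListBlank` identifies this with
nothing. -/
theorem upd_push (L : List Γ) (a : Γ) :
    LM.upd (some .right) a none (stackTape L) = stackTape (a :: L) := by
  cases L with
  | nil =>
    have := Turing.ListBlank.cons_head_tail (Turing.ListBlank.mk ([] : List Γ))
    simp only [Turing.ListBlank.head_mk, Turing.ListBlank.tail_mk] at this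
    simpa [LM.upd, shift, stackTape, Turing.Tape.move, Turing.Tape.write] using this
  | cons b L =>
    simp [LM.upd, shift, stackTape, Turing.Tape.move, Turing.Tape.write]

theorem upd_pop (L : List Γ) :
    LM.upd none default (some .left) (stackTape L) = stackTape L.tail := by
  have := Turing.ListBlank.cons_head_tail (Turing.ListBlank.mk ([] : List Γ))
  simp only [Turing.ListBlank.head_mk, Turing.ListBlank.tail_mk] at this
  simpa [LM.upd, shift, stackTape, Turing.Tape.move, Turing.Tape.write] using this

theorem upd_id (T : Turing.Tape Γ) : LM.upd none T.head none T = T := rfl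

end Stack

/-- The control states of the machine for a code that are not inherited from the stack machine. -/
inductive Ctl
  | start | start' | scan | push (b : Bool) | out | pend (b : Bool) | emit (b b' : Bool) | halt

instance : Finite Ctl := by
  let f : Ctl → Fin 8 × Bool × Bool
    | .start => (0, true, true)
    | .start' => (1, true, true)
    | .scan => (2, true, true)
    | .push b => (3, b, true)
    | .out => (4, true, true)
    | .pend b => (5, b, true)
    | .emit b b' => (6, b, b')
    | .halt => (7, true, true)
  refine Finite.of_injective f ?_
  rintro (_ | _ | _ | b | _ | b | ⟨b, b'⟩ | _) (_ | _ | _ | d | _ | d | ⟨d, d'⟩ | _) <;> simp [f]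

/-- The statements of the stack machine. -/
abbrev Stm : Type := Turing.TM2.Stmt (fun _ : K' => Γ') Λ' (Option Γ')

/-- The program of the stack machine. -/
abbrev stmAt : Λ' → Stm := Turing.PartrecToTM2.tr

/-- The labels of the stack machine that are used for the code `c`. -/
noncomputable abbrev supp (c : Turing.ToPartrec.Code) : Finset Λ' :=
  Turing.PartrecToTM2.codeSupp c Cont'.halt

/-- The statements of the stack machine that are used for the code `c`. -/
def Pos (c : Turing.ToPartrec.Code) : Type :=
  {q : Stm // some q ∈ Turing.TM2.stmts stmAt (supp c)}

instance (c : Turing.ToPartrec.Code) : Finite (Pos c) := by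
  refine Finite.of_injective (β := Turing.TM2.stmts stmAt (supp c)) (fun q => ⟨some q.1, q.2⟩) ?_
  intro q q' h
  exact Subtype.ext (Option.some.inj (congrArg Subtype.val h))

/-- The control states of the machine for the code `c`. -/
abbrev St (c : Turing.ToPartrec.Code) : Type := Ctl ⊕ (Pos c × Option Γ')

open Classical in
/-- The control state that executes the statement `q` with local store `v`. -/
noncomputable def St.mk (c : Turing.ToPartrec.Code) (q : Stm) (v : Option Γ') : St c :=
  -- The labels of the stack machine form an infinite type; restricting to the support of `c` keeps
  -- the control finite. The second branch is a junk value that runs of `c` never meet.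
  if h : some q ∈ Turing.TM2.stmts stmAt (supp c) then .inr (⟨q, h⟩, v) else .inl .halt

/-- The tape for each stack. -/
def stk : K' → Fin 10
  | .main => 3
  | .rev => 4
  | .aux => 5
  | .stack => 6

theorem stk_injective : Injective stk := by
  rintro (_ | _ | _ | _) (_ | _ | _ | _) h <;> first | rfl | simp [stk] at h

section CodeMachine

variable {H : Type}

/-- The program of the machine for the code `c` with input tape `inp` and output tape `7`. -/
noncomputable def prog (c : Turing.ToPartrec.Code) (inp : Fin 10) :
    St c → Fin 10 × Option Turing.Dir × (Sym (Γ' ⊕ H) →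
      Sym (Γ' ⊕ H) × Option Turing.Dir × St c)
  -- The main stack is filled from the bottom: the terminator `cons`, the leading `1`, then the bits
  -- of the input. The result is `trList [num w]`.
  | .inl .start => (3, some .right, fun _ => (ofΓ' .cons, none, .inl .start'))
  | .inl .start' => (3, some .right, fun _ => (.bit true, none, .inl .scan))
  | .inl .scan => (inp, none, fun
    | .bit b => (.bit b, some .right, .inl (.push b))
    | γ => (γ, none,
      St.mk c (stmAt (Turing.PartrecToTM2.trNormal c Cont'.halt)) none))
  | .inl (.push b) => (3, some .right, fun _ => (.bit b, none, .inl .scan))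
  | .inl .out => (3, none, fun γ => (default, some .left,
      match γ with
      | .bit b => .inl (.pend b)
      | _ => .inl .halt))
  -- A bit is held back until the next symbol is known: the bit just above `cons` is the leading `1`
  -- of `num` and is dropped. As the least significant bit is popped first, the output is written
  -- from right to left.
  | .inl (.pend b) => (3, none, fun γ => (default, some .left,
      match γ with
      | .bit b' => .inl (.emit b b')
      | _ => .inl .halt))
  | .inl (.emit b b') => (7, some .left, fun _ => (.bit b, none, .inl (.pend b')))
  | .inl .halt => (3, none, fun γ => (γ, none, .inl .halt))
  | .inr (⟨Turing.TM2.Stmt.push k f q, _⟩, v) =>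
    (stk k, some .right, fun _ => (ofΓ' (f v), none, St.mk c q v))
  | .inr (⟨Turing.TM2.Stmt.peek k f q, _⟩, v) =>
    (stk k, none, fun γ => (γ, none, St.mk c q (f v (toΓ' γ))))
  | .inr (⟨Turing.TM2.Stmt.pop k f q, _⟩, v) =>
    (stk k, none, fun γ => (default, some .left, St.mk c q (f v (toΓ' γ))))
  | .inr (⟨Turing.TM2.Stmt.load a q, _⟩, v) => (3, none, fun γ => (γ, none, St.mk c q (a v)))
  | .inr (⟨Turing.TM2.Stmt.branch p q₁ q₂, _⟩, v) =>
    (3, none, fun γ => (γ, none, St.mk c (cond (p v) q₁ q₂) v))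
  | .inr (⟨Turing.TM2.Stmt.goto l, _⟩, v) =>
    (3, none, fun γ => (γ, none, St.mk c (stmAt (l v)) v))
  | .inr (⟨Turing.TM2.Stmt.halt, _⟩, _) => (3, none, fun γ => (γ, none, .inl .out))

theorem St.mk_of_mem {c : Turing.ToPartrec.Code} {q : Stm}
    (h : some q ∈ Turing.TM2.stmts stmAt (supp c)) (v : Option Γ') :
    St.mk c q v = .inr (⟨q, h⟩, v) := dif_pos h

theorem St.mk_ne (c : Turing.ToPartrec.Code) (q : Stm) (v : Option Γ') :
    St.mk c q v ≠ .inl .start := by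
  rw [St.mk]
  split <;> simp

theorem prog_cases (c : Turing.ToPartrec.Code) (inp : Fin 10) (s : St c) :
    (prog (H := H) c inp s).1 = inp ∨ (3 ≤ (prog (H := H) c inp s).1 ∧
      (prog (H := H) c inp s).1 ≤ 7) := by
  have hk : ∀ k, 3 ≤ stk k ∧ stk k ≤ 7 := by rintro (_ | _ | _ | _) <;> decide
  obtain (_ | _ | _ | b | _ | b | ⟨b, b'⟩ | _) | ⟨⟨q, h⟩, v⟩ := s
  case inr => cases q <;> simp only [prog] <;> first | exact .inr (hk _) | exact .inr (by decide)
  all_goals simp only [prog]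
  all_goals first | exact .inl trivial | exact .inl rfl | exact .inr (by decide)

theorem prog_ne_start (c : Turing.ToPartrec.Code) (inp : Fin 10) (s : St c) (γ : Sym (Γ' ⊕ H)) :
    ((prog c inp s).2.2 γ).2.2 ≠ .inl .start := by
  obtain (_ | _ | _ | b | _ | b | ⟨b, b'⟩ | _) | ⟨⟨q, h⟩, v⟩ := s
  case inr => cases q <;> first | exact St.mk_ne _ _ _ | simp [prog]
  all_goals cases γ <;> simp [prog, St.mk_ne]

/-- The machine that evaluates the code `c`, with input tape `inp` and output tape `7`. -/
noncomputable def codeLM (c : Turing.ToPartrec.Code) {inp : Fin 10} (hinp : inp < 3)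
    {enc : St c → H} (henc : Injective enc) : LM (Fin 10) (Sym (Γ' ⊕ H)) where
  S := St c
  finS := inferInstance
  tp s := (prog (H := H) c inp s).1
  pre s := (prog (H := H) c inp s).2.1
  act s := (prog (H := H) c inp s).2.2
  start := .inl .start
  halt := .inl .halt
  act_ne_start := prog_ne_start c inp
  h₁ := 8
  h₂ := 9
  h₁_ne_h₂ := by decide
  tp_ne_h₁ s := by
    have := prog_cases (H := H) c inp s
    omega
  tp_ne_h₂ s := by
    have := prog_cases (H := H) c inp s
    omega
  enc s := .aux (.inr (enc s))
  enc_injective := by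
    intro s t h
    simpa [henc.eq_iff] using h

end CodeMachine

section CodeRun

variable {H : Type}

/-- The tapes `τ` hold the stacks `S`. -/
def Stacks (τ : Fin 10 → Turing.Tape (Sym (Γ' ⊕ H))) (S : K' → List Γ') : Prop :=
  ∀ k, τ (stk k) = stackTape ((S k).map ofΓ')

theorem Stacks.update {τ : Fin 10 → Turing.Tape (Sym (Γ' ⊕ H))} {S : K' → List Γ'}
    (h : Stacks τ S) (k : K') (L : List Γ') :
    Stacks (update τ (stk k) (stackTape (L.map ofΓ'))) (update S k L) := by
  intro k'
  by_cases hk : k' = k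
  · subst hk
    simp
  · rw [update_of_ne (stk_injective.ne hk), update_of_ne hk, h]

variable {c : Turing.ToPartrec.Code} {inp : Fin 10} (hinp : inp < 3) {enc : St c → H}
  (henc : Injective enc)

theorem codeLM_step {s : St c} (hs : s ≠ .inl .halt) {τ : Fin 10 → Turing.Tape (Sym (Γ' ⊕ H))}
    {k d f} (hp : prog c inp s = (k, d, f)) {γ' d' s'}
    (hf : f (shift d (τ k)).head = (γ', d', s')) {T'} (hT : LM.upd d γ' d' (τ k) = T') :
    (codeLM c hinp henc).Step (s, τ) (s', update τ k T') := by
  refine ⟨hs, ?_⟩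
  simp only [LM.nextTape, LM.sym, codeLM, hp, hf, hT]

theorem codeLM_step_id {s : St c} (hs : s ≠ .inl .halt)
    {τ : Fin 10 → Turing.Tape (Sym (Γ' ⊕ H))} {k f} (hp : prog c inp s = (k, none, f)) {s'}
    (hf : f (τ k).head = ((τ k).head, none, s')) :
    (codeLM c hinp henc).Step (s, τ) (s', τ) := by
  have := codeLM_step hinp henc hs hp (τ := τ) hf rfl
  rwa [show LM.upd none _ none (τ k) = τ k from upd_id (τ k), update_eq_self] at this

/-- The control state that corresponds to a description of the stack machine. -/
noncomputable def St.ofCfg (c : Turing.ToPartrec.Code)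
    (x : Turing.TM2.Cfg (fun _ : K' => Γ') Λ' (Option Γ')) : St c :=
  match x.l with
  | some l => St.mk c (stmAt l) x.var
  | none => .inl .out

/-- Each primitive stack operation touches at most one stack, hence is a single step here.
Substatements stay in the support by `stmts_trans`. -/
theorem stmt_reaches (q : Stm)
    (hq : some q ∈ Turing.TM2.stmts stmAt (supp c))
    (v : Option Γ') {S : K' → List Γ'} {τ : Fin 10 → Turing.Tape (Sym (Γ' ⊕ H))}
    (hτ : Stacks τ S) :
    ∃ τ', Stacks τ' (Turing.TM2.stepAux q v S).stk ∧ (∀ i, (∀ k, i ≠ stk k) → τ' i = τ i) ∧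
      ReflTransGen (codeLM c hinp henc).Step (St.mk c q v, τ)
        (St.ofCfg c (Turing.TM2.stepAux q v S), τ') := by
  classical
  have hmk := St.mk_of_mem hq
  induction q generalizing v S τ with
  | push k f q ih =>
    have hq' := Turing.TM2.stmts_trans (M := stmAt) (S := supp c)
      (by simp only [Turing.TM2.stmts₁]; exact Finset.mem_insert_of_mem Turing.TM2.stmts₁_self) hq
    have st : (codeLM c hinp henc).Step (St.mk c (Turing.TM2.Stmt.push k f q) v, τ)
        (St.mk c q v, update τ (stk k) (stackTape ((f v :: S k).map ofΓ'))) := by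
      rw [hmk]
      refine codeLM_step hinp henc (by simp) rfl rfl ?_
      rw [hτ k, upd_push]
      rfl
    obtain ⟨τ', h₁, h₂, h₃⟩ := ih hq' v (hτ.update k (f v :: S k))
      (St.mk_of_mem hq')
    refine ⟨τ', h₁, fun i hi => ?_, .head st h₃⟩
    rw [h₂ i hi, update_of_ne (hi k)]
  | peek k f q ih =>
    have hq' := Turing.TM2.stmts_trans (M := stmAt) (S := supp c)
      (by simp only [Turing.TM2.stmts₁]; exact Finset.mem_insert_of_mem Turing.TM2.stmts₁_self) hq
    have st : (codeLM c hinp henc).Step (St.mk c (Turing.TM2.Stmt.peek k f q) v, τ)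
        (St.mk c q (f v (S k).head?), τ) := by
      rw [hmk]
      refine codeLM_step_id hinp henc (by simp) rfl ?_
      rw [hτ k, ← toΓ'_headI (H := H)]
      rfl
    obtain ⟨τ', h₁, h₂, h₃⟩ := ih hq' (f v (S k).head?) hτ
      (St.mk_of_mem hq')
    exact ⟨τ', h₁, h₂, .head st h₃⟩
  | pop k f q ih =>
    have hq' := Turing.TM2.stmts_trans (M := stmAt) (S := supp c)
      (by simp only [Turing.TM2.stmts₁]; exact Finset.mem_insert_of_mem Turing.TM2.stmts₁_self) hq
    have st : (codeLM c hinp henc).Step (St.mk c (Turing.TM2.Stmt.pop k f q) v, τ)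
        (St.mk c q (f v (S k).head?), update τ (stk k) (stackTape ((S k).tail.map ofΓ'))) := by
      rw [hmk, ← toΓ'_headI (H := H)]
      refine codeLM_step hinp henc (by simp) rfl (γ' := default) (d' := some .left) ?_ ?_
      · rw [hτ k]
        rfl
      · rw [hτ k, upd_pop, List.map_tail]
    obtain ⟨τ', h₁, h₂, h₃⟩ := ih hq' (f v (S k).head?) (hτ.update k (S k).tail)
      (St.mk_of_mem hq')
    refine ⟨τ', h₁, fun i hi => ?_, .head st h₃⟩
    rw [h₂ i hi, update_of_ne (hi k)]
  | load a q ih =>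
    have hq' := Turing.TM2.stmts_trans (M := stmAt) (S := supp c)
      (by simp only [Turing.TM2.stmts₁]; exact Finset.mem_insert_of_mem Turing.TM2.stmts₁_self) hq
    have st : (codeLM c hinp henc).Step (St.mk c (Turing.TM2.Stmt.load a q) v, τ)
        (St.mk c q (a v), τ) := by
      rw [hmk]
      exact codeLM_step_id hinp henc (by simp) rfl rfl
    obtain ⟨τ', h₁, h₂, h₃⟩ := ih hq' (a v) hτ (St.mk_of_mem hq')
    exact ⟨τ', h₁, h₂, .head st h₃⟩
  | branch p q₁ q₂ ih₁ ih₂ =>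
    have hq₁ := Turing.TM2.stmts_trans (M := stmAt) (S := supp c)
      (by
        simp only [Turing.TM2.stmts₁]
        exact Finset.mem_insert_of_mem (Finset.mem_union_left _ Turing.TM2.stmts₁_self)) hq
    have hq₂ := Turing.TM2.stmts_trans (M := stmAt) (S := supp c)
      (by
        simp only [Turing.TM2.stmts₁]
        exact Finset.mem_insert_of_mem (Finset.mem_union_right _ Turing.TM2.stmts₁_self)) hq
    have st : (codeLM c hinp henc).Step (St.mk c (Turing.TM2.Stmt.branch p q₁ q₂) v, τ)
        (St.mk c (cond (p v) q₁ q₂) v, τ) := by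
      rw [hmk]
      exact codeLM_step_id hinp henc (by simp) rfl rfl
    cases hp : p v
    · obtain ⟨τ', h₁, h₂, h₃⟩ := ih₂ hq₂ v hτ (St.mk_of_mem hq₂)
      rw [hp] at st
      simp only [Turing.TM2.stepAux, hp, cond_false]
      exact ⟨τ', h₁, h₂, .head st h₃⟩
    · obtain ⟨τ', h₁, h₂, h₃⟩ := ih₁ hq₁ v hτ (St.mk_of_mem hq₁)
      rw [hp] at st
      simp only [Turing.TM2.stepAux, hp, cond_true]
      exact ⟨τ', h₁, h₂, .head st h₃⟩
  | goto l =>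
    refine ⟨τ, hτ, fun _ _ => rfl, .single ?_⟩
    rw [hmk]
    exact codeLM_step_id hinp henc (by simp) rfl rfl
  | halt =>
    refine ⟨τ, hτ, fun _ _ => rfl, .single ?_⟩
    rw [hmk]
    exact codeLM_step_id hinp henc (by simp) rfl rfl

theorem cfg_reaches {x y : Turing.TM2.Cfg (fun _ : K' => Γ') Λ' (Option Γ')}
    (h : Turing.TM2.Reaches stmAt x y)
    (hx : x.l ∈ Finset.insertNone (supp c))
    {τ : Fin 10 → Turing.Tape (Sym (Γ' ⊕ H))} (hτ : Stacks τ x.stk) :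
    ∃ τ', Stacks τ' y.stk ∧ (∀ i, (∀ k, i ≠ stk k) → τ' i = τ i) ∧
      ReflTransGen (codeLM c hinp henc).Step (St.ofCfg c x, τ) (St.ofCfg c y, τ') := by
  induction h using ReflTransGen.head_induction_on generalizing τ with
  | refl => exact ⟨τ, hτ, fun _ _ => rfl, .refl⟩
  | @head x z hxz _ ih =>
    have hz := @Turing.TM2.step_supports _ _ _ _ ⟨Turing.PartrecToTM2.trNormal c Cont'.halt⟩ _
      stmAt _ (Turing.PartrecToTM2.tr_supports c Cont'.halt) _ _ hxz hx
    obtain ⟨_ | l, v, S⟩ := x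
    · cases hxz
    have hz' : z = Turing.TM2.stepAux (stmAt l) v S := (Option.some.inj hxz).symm
    subst hz'
    have hl : l ∈ Turing.PartrecToTM2.codeSupp c Cont'.halt := by simpa using hx
    obtain ⟨τ₁, h₁, h₂, h₃⟩ := stmt_reaches hinp henc (stmAt l)
      (by
        classical
        exact Finset.some_mem_insertNone.2
          (Finset.mem_biUnion.2 ⟨l, hl, Turing.TM2.stmts₁_self⟩)) v hτ
    obtain ⟨τ₂, h₁', h₂', h₃'⟩ := ih hz h₁
    exact ⟨τ₂, h₁', fun i hi => (h₂' i hi).trans (h₂ i hi), h₃.trans h₃'⟩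

theorem scan_reaches (w l : List Bool) (L : List Γ') {τ : Fin 10 → Turing.Tape (Sym (Γ' ⊕ H))}
    (hi : τ inp = Turing.Tape.mk₂ (l.map Sym.bit) (w.map Sym.bit))
    (hm : τ 3 = stackTape (L.map ofΓ')) :
    ∃ τ', (∀ i, i ≠ inp → i ≠ 3 → τ' i = τ i) ∧
      τ' 3 = stackTape ((w.reverse.map bitΓ' ++ L).map ofΓ') ∧
      ReflTransGen (codeLM c hinp henc).Step (.inl .scan, τ)
        (St.mk c (stmAt (Turing.PartrecToTM2.trNormal c Cont'.halt)) none, τ') := by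
  induction w generalizing l L τ with
  | nil =>
    refine ⟨τ, fun _ _ _ => rfl, by simpa using hm, .single ?_⟩
    refine codeLM_step_id hinp henc (by simp) rfl ?_
    rw [hi]
    rfl
  | cons b w ih =>
    have h3 : (3 : Fin 10) ≠ inp := by omega
    have s₁ : (codeLM c hinp henc).Step (.inl .scan, τ) (.inl (.push b),
        update τ inp (Turing.Tape.mk₂ ((b :: l).map Sym.bit) (w.map Sym.bit))) := by
      refine codeLM_step hinp henc (by simp) rfl (γ' := .bit b) (d' := some .right) ?_ ?_
      · rw [hi]
        rfl
      · rw [hi]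
        exact Tape.move_right_mk₂ _ _ _
    have s₂ : (codeLM c hinp henc).Step (.inl (.push b),
        update τ inp (Turing.Tape.mk₂ ((b :: l).map Sym.bit) (w.map Sym.bit))) (.inl .scan,
        update (update τ inp (Turing.Tape.mk₂ ((b :: l).map Sym.bit) (w.map Sym.bit))) 3
          (stackTape ((bitΓ' b :: L).map ofΓ'))) := by
      refine codeLM_step hinp henc (by simp) rfl rfl ?_
      rw [update_of_ne h3, hm, upd_push, List.map_cons, ofΓ'_bitΓ']
    obtain ⟨τ', h₁, h₂, h₃⟩ := ih (b :: l) (bitΓ' b :: L)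
      (τ := update (update τ inp (Turing.Tape.mk₂ ((b :: l).map Sym.bit) (w.map Sym.bit))) 3
          (stackTape ((bitΓ' b :: L).map ofΓ'))) (by simp [h3.symm]) (by simp)
    refine ⟨τ', fun i hi₁ hi₂ => ?_, ?_, .head s₁ (.head s₂ h₃)⟩
    · rw [h₁ i hi₁ hi₂, update_of_ne hi₂, update_of_ne hi₁]
    · rw [h₂]
      simp

theorem pend_reaches (r : List Bool) (b : Bool) (u : List Bool)
    {τ : Fin 10 → Turing.Tape (Sym (Γ' ⊕ H))} (ho : τ 7 = wordTape _ u)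
    (hm : τ 3 = stackTape ((r.map bitΓ' ++ [Γ'.cons]).map ofΓ')) :
    ∃ τ', τ' 7 = wordTape _ (((b :: r).dropLast).reverse ++ u) ∧
      ReflTransGen (codeLM c hinp henc).Step (.inl (.pend b), τ) (.inl .halt, τ') := by
  induction r generalizing b u τ with
  | nil =>
    refine ⟨update τ 3 (stackTape []), by simpa using ho, .single ?_⟩
    refine codeLM_step hinp henc (by simp) rfl (γ' := default) (d' := some .left) ?_ ?_
    · rw [hm]
      rfl
    · rw [hm]
      exact upd_pop _
  | cons b' r ih =>
    have s₁ : (codeLM c hinp henc).Step (.inl (.pend b), τ) (.inl (.emit b b'),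
        update τ 3 (stackTape ((r.map bitΓ' ++ [Γ'.cons]).map ofΓ'))) := by
      refine codeLM_step hinp henc (by simp) rfl (γ' := default) (d' := some .left) ?_ ?_
      · rw [hm, List.map_cons, List.cons_append, List.map_cons, ofΓ'_bitΓ']
        rfl
      · rw [hm]
        exact upd_pop _
    have s₂ : (codeLM c hinp henc).Step (.inl (.emit b b'),
        update τ 3 (stackTape ((r.map bitΓ' ++ [Γ'.cons]).map ofΓ'))) (.inl (.pend b'),
        update (update τ 3 (stackTape ((r.map bitΓ' ++ [Γ'.cons]).map ofΓ'))) 7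
          (wordTape _ (b :: u))) := by
      refine codeLM_step hinp henc (by simp) rfl rfl ?_
      rw [update_of_ne (show (7 : Fin 10) ≠ 3 by decide), ho]
      simp only [LM.upd, shift, wordTape, Turing.Tape.mk₁, Tape.move_left_mk₂_nil]
      rfl
    obtain ⟨τ', h₁, h₂⟩ := ih b' (b :: u) (τ := update (update τ 3 (stackTape
      ((r.map bitΓ' ++ [Γ'.cons]).map ofΓ'))) 7 (wordTape _ (b :: u))) (by simp) (by simp)
    refine ⟨τ', ?_, .head s₁ (.head s₂ h₂)⟩
    rw [h₁]
    simp

theorem out_reaches (u : List Bool) {τ : Fin 10 → Turing.Tape (Sym (Γ' ⊕ H))}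
    (ho : τ 7 = wordTape _ [])
    (hm : τ 3 = stackTape ((Turing.PartrecToTM2.trList [num u]).map ofΓ')) :
    ∃ τ', τ' 7 = wordTape _ u ∧
      ReflTransGen (codeLM c hinp henc).Step (.inl .out, τ) (.inl .halt, τ') := by
  have key : ∃ b r, Turing.PartrecToTM2.trList [num u] = bitΓ' b :: (r.map bitΓ' ++ [Γ'.cons]) ∧
      (b :: r).dropLast.reverse = u := by
    obtain ⟨b, r, h⟩ : ∃ b r, u.reverse ++ [true] = b :: r := by
      cases u.reverse with
      | nil => exact ⟨_, _, rfl⟩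
      | cons a l => exact ⟨_, _, rfl⟩
    refine ⟨b, r, ?_, by rw [← h]; simp⟩
    have : bitΓ' b :: (r.map bitΓ' ++ [Γ'.cons]) = (b :: r).map bitΓ' ++ [Γ'.cons] := rfl
    rw [this, ← h]
    simp [trNat_num, bitΓ']
  obtain ⟨b, r, h₁, h₂⟩ := key
  rw [h₁] at hm
  have s₁ : (codeLM c hinp henc).Step (.inl .out, τ) (.inl (.pend b),
      update τ 3 (stackTape ((r.map bitΓ' ++ [Γ'.cons]).map ofΓ'))) := by
    refine codeLM_step hinp henc (by simp) rfl (γ' := default) (d' := some .left) ?_ ?_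
    · rw [hm, List.map_cons, ofΓ'_bitΓ']
      rfl
    · rw [hm]
      exact upd_pop _
  obtain ⟨τ', h, hr⟩ := pend_reaches hinp henc r b []
    (τ := update τ 3 (stackTape ((r.map bitΓ' ++ [Γ'.cons]).map ofΓ'))) (by simpa using ho)
    (by simp)
  exact ⟨τ', by rw [h, h₂, List.append_nil], .head s₁ hr⟩

/-- The machine for the code `c` evaluates `c`. -/
theorem codeLM_reaches {w u : List Bool} (hc : [num u] ∈ c.eval [num w])
    {τ : Fin 10 → Turing.Tape (Sym (Γ' ⊕ H))} (hi : τ inp = wordTape _ w)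
    (hb : ∀ i, 3 ≤ i → τ i = wordTape _ []) :
    ∃ τ', τ' 7 = wordTape _ u ∧
      ReflTransGen (codeLM c hinp henc).Step (.inl .start, τ) (.inl .halt, τ') := by
  have h3 : (3 : Fin 10) ≠ inp := by omega
  have s₁ : (codeLM c hinp henc).Step (.inl .start, τ) (.inl .start',
      update τ 3 (stackTape (([Γ'.cons] : List Γ').map ofΓ'))) := by
    refine codeLM_step hinp henc (by simp) rfl rfl ?_
    rw [hb 3 le_rfl]
    exact upd_push [] _
  have s₂ : (codeLM c hinp henc).Step (.inl .start',
      update τ 3 (stackTape (([Γ'.cons] : List Γ').map ofΓ'))) (.inl .scan,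
      update τ 3 (stackTape (([.bit1, .cons] : List Γ').map ofΓ'))) := by
    have := codeLM_step hinp henc (s := .inl .start') (by simp) (τ := update τ 3
      (stackTape (([Γ'.cons] : List Γ').map ofΓ'))) rfl rfl rfl
    rw [update_idem, update_self, upd_push] at this
    exact this
  obtain ⟨τ₁, h₁, h₂, h₃⟩ := scan_reaches hinp henc w [] [.bit1, .cons] (τ := update τ 3
    (stackTape (([.bit1, .cons] : List Γ').map ofΓ'))) (by rw [update_of_ne h3.symm, hi]; rfl)
    (by simp)
  have hev : Turing.PartrecToTM2.halt [num u] ∈ StateTransition.eval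
      (Turing.TM2.step Turing.PartrecToTM2.tr) (Turing.PartrecToTM2.init c [num w]) := by
    rw [Turing.PartrecToTM2.tr_eval]
    exact Part.mem_map _ hc
  have hr := (StateTransition.mem_eval.1 hev).1
  obtain ⟨τ₂, h₁', h₂', h₃'⟩ := cfg_reaches hinp henc (c := c) hr
    (by
      simp only [Turing.PartrecToTM2.init, Finset.some_mem_insertNone]
      exact (Turing.PartrecToTM2.tr_supports c Cont'.halt).1) (τ := τ₁)
    (by
      have hb' : ∀ i, 3 < i → τ₁ i = wordTape _ [] := fun i hi' => by
        rw [h₁ i (by omega) (by omega), update_of_ne (by omega), hb i hi'.le]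
      rintro (_ | _ | _ | _)
      · simp only [stk, Turing.PartrecToTM2.init, K'.elim, Turing.PartrecToTM2.trList, trNat_num]
        rw [h₂]
        simp
      · exact hb' 4 (by decide)
      · exact hb' 5 (by decide)
      · exact hb' 6 (by decide))
  obtain ⟨τ₃, ho, hr'⟩ := out_reaches hinp henc u (τ := τ₂)
    (by
      rw [h₂' 7 (by rintro (_ | _ | _ | _) <;> decide), h₁ 7 (by omega) (by decide),
        update_of_ne (by decide), hb 7 (by decide)])
    (h₁' .main)
  exact ⟨τ₃, ho, .head s₁ (.head s₂ (h₃.trans (h₃'.trans hr')))⟩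

end CodeRun

/-! ### Compute, copy, uncompute -/

section Evaluation

variable {H : Type} [Finite H]

instance : Finite Γ' := Finite.of_fintype _

instance {A : Type} [Finite A] : Finite (Sym A) := by
  refine Finite.of_injective (β := Option (Bool ⊕ A)) (fun
    | .blank => none
    | .bit b => some (.inl b)
    | .aux a => some (.inr a)) ?_
  rintro (_ | _ | _) (_ | _ | _) <;> simp

theorem copier_word {A : Type} {i j : Fin 10} (hij : i ≠ j) {τ : Fin 10 → Turing.Tape (Sym A)}
    {w : List Bool} (hi : τ i = wordTape A w) (hj : τ j = wordTape A []) :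
    (copier hij).Computes τ (update τ j (wordTape A w)) := by
  refine copier_computes hij τ _ ?_ hi hj
  intro γ hγ
  obtain ⟨b, -, rfl⟩ := List.mem_map.1 hγ
  exact fun h => by cases h

variable {c : Turing.ToPartrec.Code} {inp cpy : Fin 10}

/-- The reversible machine that computes, on the tape `cpy`, the value of the code `c` at the word
on the tape `inp`. -/
noncomputable def evaluator (hinp : inp < 3) (hcpy : cpy < 3) {enc : St c → H}
    (henc : Injective enc) : RM (Fin 10) (Sym (Γ' ⊕ H)) :=
  ((codeLM c hinp henc).logger.seq (copier (i := 7) (j := cpy) (by omega))).seq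
    (codeLM c hinp henc).logger.inv

/-- Bennett's argument: the simulation never touches the tape `cpy`, so the same final tapes `σ'`
arise whether it is blank or already holds `u`. After the copy, the inverse run therefore restores
everything except `cpy`. -/
theorem evaluator_computes (hinp : inp < 3) (hcpy : cpy < 3) (hne : inp ≠ cpy) {enc : St c → H}
    (henc : Injective enc) {w u : List Bool} (hc : [num u] ∈ c.eval [num w])
    {τ : Fin 10 → Turing.Tape (Sym (Γ' ⊕ H))} (hi : τ inp = wordTape _ w)
    (hj : τ cpy = wordTape _ []) (hb : ∀ i, 3 ≤ i → τ i = wordTape _ []) :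
    (evaluator hinp hcpy henc).Computes τ (update τ cpy (wordTape _ u)) := by
  obtain ⟨τ', ho, hr⟩ := codeLM_reaches hinp henc hc hi hb
  have h7 : (7 : Fin 10) ≠ cpy := by omega
  obtain ⟨σ', hσ, hX⟩ := (codeLM c hinp henc).logger_reaches (c := cpy)
    (fun s => by
      have := prog_cases (H := H) c inp s
      change (prog (H := H) c inp s).1 ≠ cpy
      omega)
    (show cpy ≠ 8 by omega) (show cpy ≠ 9 by omega) hr (σ := τ) (fun _ _ _ => rfl)
    (by change (τ 8).right = _; rw [hb 8 (by decide)]; rfl)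
    (by change (τ 9).right = _; rw [hb 9 (by decide)]; rfl)
  have e₁ : (codeLM c hinp henc).logger.Computes τ (update σ' cpy (wordTape _ [])) := by
    have := hX (wordTape _ [])
    rwa [← hj, update_eq_self, hj] at this
  have e₂ : (copier (Γ := Sym (Γ' ⊕ H)) h7).Computes (update σ' cpy (wordTape _ []))
      (update σ' cpy (wordTape _ u)) := by
    have := copier_word h7 (τ := update σ' cpy (wordTape (Γ' ⊕ H) [])) (w := u)
      (by rw [update_of_ne h7, hσ 7 (show (7 : Fin 10) ≠ 8 by decide)
        (show (7 : Fin 10) ≠ 9 by decide), ho]) (by simp)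
    rwa [update_idem] at this
  have e₃ : (codeLM c hinp henc).logger.Computes (update τ cpy (wordTape _ u))
      (update σ' cpy (wordTape _ u)) := hX _
  exact (e₁.seq e₂).seq e₃.inv

/-- The tapes with the words `w₀`, `w₁`, `w₂` on the first three tapes and blanks elsewhere. -/
def tapes3 (A : Type) (w₀ w₁ w₂ : List Bool) : Fin 10 → Turing.Tape (Sym A) := fun i =>
  if i = 0 then wordTape A w₀ else if i = 1 then wordTape A w₁ else if i = 2 then wordTape A w₂
  else wordTape A []

section tapes3

variable {A : Type} (w₀ w₁ w₂ w : List Bool)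

theorem tapes3_blank (i : Fin 10) (hi : 3 ≤ i) : tapes3 A w₀ w₁ w₂ i = wordTape A [] := by
  rw [tapes3, if_neg (by omega), if_neg (by omega), if_neg (by omega)]

theorem update_tapes3_zero : update (tapes3 A w₀ w₁ w₂) 0 (wordTape A w) = tapes3 A w w₁ w₂ := by
  funext i
  by_cases h : i = 0
  · subst h
    simp [tapes3]
  · simp [tapes3, h]

theorem update_tapes3_one : update (tapes3 A w₀ w₁ w₂) 1 (wordTape A w) = tapes3 A w₀ w w₂ := by
  funext i
  by_cases h : i = 1
  · subst h
    simp [tapes3]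
  · simp [tapes3, h]

theorem update_tapes3_two : update (tapes3 A w₀ w₁ w₂) 2 (wordTape A w) = tapes3 A w₀ w₁ w := by
  funext i
  by_cases h : i = 2
  · subst h
    simp [tapes3]
  · simp [tapes3, h]

end tapes3

/-- Every function on words that is computed by a code is computed by a Turing machine. -/
theorem exists_outputs (c : Turing.ToPartrec.Code) :
    ∃ T : TM, ∀ w u : List Bool, [num u] ∈ c.eval [num w] → T.Outputs w u := by
  have h₀₂ : (0 : Fin 10) ≠ 2 := by decide
  -- Copying from tape 0 to tape 2 and then uncopying in the other direction moves the input away,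
  -- so that tape 0 is free for the output.
  let M : RM (Fin 10) (Sym (Γ' ⊕ St c)) := ((copier h₀₂).seq (copier h₀₂.symm).inv).seq
    (evaluator (c := c) (inp := 2) (cpy := 0) (by decide) (by decide) injective_id)
  refine ⟨M.toTM, fun w u h => ?_⟩
  have e₁ : (copier h₀₂).Computes (tapes3 (Γ' ⊕ St c) w [] []) (tapes3 (Γ' ⊕ St c) w [] w) := by
    rw [← update_tapes3_two w [] [] w]
    exact copier_word h₀₂ (by simp [tapes3]) (by simp [tapes3])
  have e₂ : (copier h₀₂.symm).Computes (tapes3 (Γ' ⊕ St c) [] [] w)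
      (tapes3 (Γ' ⊕ St c) w [] w) := by
    rw [← update_tapes3_zero [] [] w w]
    exact copier_word h₀₂.symm (by simp [tapes3]) (by simp [tapes3])
  have e₃ : (evaluator (c := c) (inp := 2) (cpy := 0) (by decide) (by decide)
      injective_id).Computes (tapes3 (Γ' ⊕ St c) [] [] w) (tapes3 (Γ' ⊕ St c) u [] w) := by
    rw [← update_tapes3_zero [] [] w u]
    exact evaluator_computes _ _ (by decide) _ h (by simp [tapes3]) (by simp [tapes3])
      (tapes3_blank _ _ _)
  obtain ⟨m, hm⟩ := M.run_of_reflTransGen ((e₁.seq e₂.inv).seq e₃)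
  have hinit : M.toTM.init w = ⟨some M.start, tapes3 (Γ' ⊕ St c) w [] []⟩ := by
    refine Cfg.ext rfl (funext fun i => ?_)
    simp [TM.init, TM.cleanCfg, tapes3]
  exact ⟨m, m, le_rfl, _, by rw [hinit, hm], rfl, by simp [tapes3]⟩

/-- If two codes compute mutually inverse functions, then these functions are computed by a
reversible Turing machine. -/
theorem exists_reversible (f g : Turing.ToPartrec.Code) :
    ∃ R : TM, R.Reversible ∧ ∀ w u : List Bool, [num u] ∈ f.eval [num w] →
      [num w] ∈ g.eval [num u] → R.OutputsClean w u := by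
  have h₀₁ : (0 : Fin 10) ≠ 1 := by decide
  let F : RM (Fin 10) (Sym (Γ' ⊕ (St f ⊕ St g))) :=
    evaluator (c := f) (inp := 0) (cpy := 1) (by decide) (by decide)
    (Sum.inl_injective (β := St g))
  let G : RM (Fin 10) (Sym (Γ' ⊕ (St f ⊕ St g))) :=
    evaluator (c := g) (inp := 1) (cpy := 0) (by decide) (by decide)
    (Sum.inr_injective (α := St f))
  -- On tapes 0 and 1 the contents go `(w, ε) → (w, u) → (ε, u) → (u, u) → (u, ε)`. The second arrow
  -- is `G` backwards: since `g` recomputes `w` from `u`, the input can be erased.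
  let M : RM (Fin 10) (Sym (Γ' ⊕ (St f ⊕ St g))) :=
    ((F.seq G.inv).seq (copier h₀₁.symm)).seq (copier h₀₁).inv
  refine ⟨M.toTM, M.toTM_reversible, fun w u hf hg => ?_⟩
  have e₁ : F.Computes (tapes3 (Γ' ⊕ (St f ⊕ St g)) w [] [])
      (tapes3 (Γ' ⊕ (St f ⊕ St g)) w u []) := by
    rw [← update_tapes3_one w [] [] u]
    exact evaluator_computes _ _ (by decide) _ hf (by simp [tapes3]) (by simp [tapes3])
      (tapes3_blank _ _ _)
  have e₂ : G.Computes (tapes3 (Γ' ⊕ (St f ⊕ St g)) [] u [])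
      (tapes3 (Γ' ⊕ (St f ⊕ St g)) w u []) := by
    rw [← update_tapes3_zero [] u [] w]
    exact evaluator_computes _ _ (by decide) _ hg (by simp [tapes3]) (by simp [tapes3])
      (tapes3_blank _ _ _)
  have e₃ : (copier h₀₁.symm).Computes (tapes3 (Γ' ⊕ (St f ⊕ St g)) [] u [])
      (tapes3 (Γ' ⊕ (St f ⊕ St g)) u u []) := by
    rw [← update_tapes3_zero [] u [] u]
    exact copier_word h₀₁.symm (by simp [tapes3]) (by simp [tapes3])
  have e₄ : (copier h₀₁).Computes (tapes3 (Γ' ⊕ (St f ⊕ St g)) u [] [])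
      (tapes3 (Γ' ⊕ (St f ⊕ St g)) u u []) := by
    rw [← update_tapes3_one u [] [] u]
    exact copier_word h₀₁ (by simp [tapes3]) (by simp [tapes3])
  obtain ⟨m, hm⟩ := M.run_of_reflTransGen (((e₁.seq e₂.inv).seq e₃).seq e₄.inv)
  have hcfg : ∀ q v, M.toTM.cleanCfg q v = ⟨q, tapes3 (Γ' ⊕ (St f ⊕ St g)) v [] []⟩ := fun q v => by
    refine Cfg.ext rfl (funext fun i => ?_)
    simp [TM.cleanCfg, tapes3]
  exact ⟨m, by rw [TM.init, hcfg, hcfg]; exact hm⟩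

end Evaluation

/-! ### Instantaneous descriptions as finite data -/

section Canonical

variable {Γ : Type} [Inhabited Γ]

open Classical in
/-- Add a symbol to the front of a list without trailing blanks. -/
noncomputable def scons (a : Γ) (l : List Γ) : List Γ :=
  if a = default ∧ l = [] then [] else a :: l

theorem tail_scons (a : Γ) (l : List Γ) : (scons a l).tail = l := by
  rw [scons]
  split_ifs with h
  · exact h.2.symm
  · rfl

theorem headI_scons (a : Γ) (l : List Γ) : (scons a l).headI = a := by
  rw [scons]
  split_ifs with h
  · exact h.1.symm
  · rfl

/-- Trailing blanks vanish under `scons`, which is what makes `canon` well defined on half-tapes. -/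
theorem foldr_scons_replicate (n : ℕ) :
    (List.replicate n (default : Γ)).foldr scons [] = [] := by
  induction n with
  | zero => rfl
  | succ n ih => simp [List.replicate_succ, ih, scons]

/-- The shortest list that represents a half-tape. -/
noncomputable def canon (L : Turing.ListBlank Γ) : List Γ :=
  L.liftOn (fun l => l.foldr scons []) <| by
    rintro a b ⟨n, rfl⟩
    simp [List.foldr_append, foldr_scons_replicate]

theorem canon_mk (l : List Γ) : canon (Turing.ListBlank.mk l) = l.foldr scons [] := rfl

theorem canon_cons (a : Γ) (L : Turing.ListBlank Γ) : canon (L.cons a) = scons a (canon L) := by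
  induction L using Turing.ListBlank.induction_on with
  | h l => rfl

theorem canon_tail (L : Turing.ListBlank Γ) : canon L.tail = (canon L).tail := by
  conv_rhs => rw [← L.cons_head_tail, canon_cons, tail_scons]

theorem headI_canon (L : Turing.ListBlank Γ) : (canon L).headI = L.head := by
  conv_lhs => rw [← L.cons_head_tail, canon_cons, headI_scons]

theorem mk_scons (a : Γ) (l : List Γ) :
    Turing.ListBlank.mk (scons a l) = (Turing.ListBlank.mk l).cons a := by
  rw [scons]
  split_ifs with h
  · rw [h.1, h.2]
    exact (Turing.ListBlank.cons_head_tail (Turing.ListBlank.mk [])).symm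
  · rfl

theorem mk_canon (L : Turing.ListBlank Γ) : Turing.ListBlank.mk (canon L) = L := by
  induction L using Turing.ListBlank.induction_on with
  | h l =>
    rw [canon_mk]
    induction l with
    | nil => rfl
    | cons a l ih => rw [List.foldr_cons, mk_scons, ih, Turing.ListBlank.cons_mk]

theorem canon_injective : Injective (canon : Turing.ListBlank Γ → List Γ) :=
  LeftInverse.injective mk_canon

/-- The representation of a tape by its head and two lists. -/
noncomputable def reprTape (T : Turing.Tape Γ) : List Γ × Γ × List Γ :=
  (canon T.left, T.head, canon T.right)

theorem reprTape_injective : Injective (reprTape : Turing.Tape Γ → _) := by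
  rintro ⟨a, l, r⟩ ⟨a', l', r'⟩ h
  simp only [reprTape, Prod.mk.injEq, canon_injective.eq_iff] at h
  simp [h]

end Canonical

section Actions

variable {A : Type}

/-- The representation of a tape with a word. -/
def wordR (A : Type) (w : List Bool) : List (Sym A) × Sym A × List (Sym A) :=
  ([], (w.map Sym.bit).headI, (w.map Sym.bit).tail)

theorem canon_word (w : List Bool) :
    canon (Turing.ListBlank.mk (w.map (Sym.bit : Bool → Sym A))) = w.map Sym.bit := by
  rw [canon_mk]
  induction w with
  | nil => rfl
  | cons b w ih =>
    rw [List.map_cons, List.foldr_cons, ih, scons, if_neg]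
    exact fun h => by cases h.1

theorem reprTape_word (w : List Bool) : reprTape (wordTape A w) = wordR A w := by
  have : (w.map (Sym.bit : Bool → Sym A)).tail = w.tail.map Sym.bit := by simp
  simp only [reprTape, wordTape, Turing.Tape.mk₁, Turing.Tape.mk₂, Turing.Tape.mk', wordR,
    Turing.ListBlank.head_mk, Turing.ListBlank.tail_mk, this, canon_word]
  rfl

open Classical in
/-- `act` on representations of tapes. -/
noncomputable def actR (a : Sym A × Option Turing.Dir) (t : List (Sym A) × Sym A × List (Sym A)) :
    List (Sym A) × Sym A × List (Sym A) :=
  if a.2 = none then (t.1, a.1, t.2.2)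
  else if a.2 = some .left then (t.1.tail, t.1.headI, scons a.1 t.2.2)
  else (scons a.1 t.1, t.2.2.headI, t.2.2.tail)

theorem reprTape_act (a : Sym A × Option Turing.Dir) (T : Turing.Tape (Sym A)) :
    reprTape (act a T) = actR a (reprTape T) := by
  obtain ⟨a, _ | _ | _⟩ := a <;> obtain ⟨h, l, r⟩ := T <;>
    simp [act, actR, reprTape, Turing.Tape.write, Turing.Tape.move, canon_cons, canon_tail,
      headI_canon]

end Actions

namespace TM

variable (M : TM)

/-- Representations of instantaneous descriptions. -/
abbrev CfgR : Type :=
  Option M.Q × (Fin (M.k + 1) → List (Sym M.A) × Sym M.A × List (Sym M.A))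

/-- The representation of an instantaneous description. -/
noncomputable def reprCfg (c : Cfg M) : M.CfgR := (c.state, fun i => reprTape (c.tape i))

theorem reprCfg_injective : Injective M.reprCfg := by
  intro c c' h
  simp only [reprCfg, Prod.mk.injEq] at h
  exact Cfg.ext h.1 (funext fun i => reprTape_injective (congrFun h.2 i))

/-- One step on representations. -/
noncomputable def stepR (c : M.CfgR) : Option M.CfgR :=
  c.1.bind fun q => (M.δ q fun i => (c.2 i).2.1).map fun p => (p.1, fun i => actR (p.2 i) (c.2 i))

/-- A number of steps on representations. -/
noncomputable def runR (n : ℕ) (c : M.CfgR) : Option M.CfgR := (·.bind M.stepR)^[n] (some c)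

/-- The representation of `cleanCfg`. -/
def cleanR (q : Option M.Q) (w : List Bool) : M.CfgR :=
  (q, fun i => if i = 0 then wordR M.A w else wordR M.A [])

theorem reprCfg_clean (q : Option M.Q) (w : List Bool) :
    M.reprCfg (M.cleanCfg q w) = M.cleanR q w := by
  refine Prod.ext rfl (funext fun i => ?_)
  by_cases h : i = 0 <;> simp [reprCfg, cleanCfg, cleanR, h, reprTape_word]

theorem stepR_repr (c : Cfg M) : M.stepR (M.reprCfg c) = (M.step c).map M.reprCfg := by
  obtain ⟨_ | q, τ⟩ := c
  · rfl
  · simp only [stepR, reprCfg, step, Option.bind_some, reprTape]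
    cases h : M.δ q fun i => (τ i).head with
    | none => simp
    | some p =>
      simp only [Option.map_some, Option.some.injEq, reprCfg, Prod.mk.injEq, true_and]
      funext i
      exact (reprTape_act _ _).symm

theorem iterate_bind_stepR_none (n : ℕ) : (·.bind M.stepR)^[n] none = none := by
  induction n with
  | zero => rfl
  | succ n ih => rw [iterate_succ_apply, Option.bind_none, ih]

theorem runR_repr (n : ℕ) (c : Cfg M) : M.runR n (M.reprCfg c) = (M.run n c).map M.reprCfg := by
  induction n generalizing c with
  | zero => rfl
  | succ n ih =>
    rw [runR, iterate_succ_apply, Option.bind_some, stepR_repr, run]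
    cases M.step c with
    | none => exact M.iterate_bind_stepR_none n
    | some c' => exact ih c'

/-- `M(w) = u` after exactly `n` steps. -/
def OutputsAt (w u : List Bool) (n : ℕ) : Prop :=
  (M.runR n (M.cleanR (some M.start) w)).map (fun c => (c.1, c.2 0)) = some (none, wordR M.A u)

/-- `M(w) = u` after exactly `n` steps, with nothing but `u` left in the memory. -/
def OutputsCleanAt (w u : List Bool) (n : ℕ) : Prop :=
  M.runR n (M.cleanR (some M.start) w) = some (M.cleanR none u)

/-- This exhibits halting with a given output as the projection of a relation that is primitive
recursive in the time `n`, ready for unbounded search. -/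
theorem outputs_iff (w u : List Bool) : M.Outputs w u ↔ ∃ n, M.OutputsAt w u n := by
  have key : ∀ n, M.OutputsAt w u n ↔
      ∃ c, M.run n (M.init w) = some c ∧ c.state = none ∧ c.tape 0 = wordTape M.A u := by
    intro n
    rw [OutputsAt, ← reprCfg_clean, runR_repr, ← init]
    cases M.run n (M.init w) with
    | none => simp
    | some c =>
      simp [reprCfg, ← reprTape_word, reprTape_injective.eq_iff]
  simp only [Outputs, OutputsWithin, key]
  exact ⟨fun ⟨_, m, _, h⟩ => ⟨m, h⟩, fun ⟨m, h⟩ => ⟨m, m, le_rfl, h⟩⟩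

theorem outputsClean_iff (w u : List Bool) :
    M.OutputsClean w u ↔ ∃ n, M.OutputsCleanAt w u n := by
  refine exists_congr fun n => ?_
  rw [OutputsCleanAt, ← reprCfg_clean, runR_repr, ← init, ← reprCfg_clean]
  cases M.run n (M.init w) <;> simp [M.reprCfg_injective.eq_iff]

end TM

/-! ### Primitive recursiveness of runs, and search -/

section Primrec

instance : Finite Turing.Dir :=
  Finite.of_injective (fun d => decide (d = Turing.Dir.left)) (by rintro (_ | _) (_ | _) <;> simp)

noncomputable instance : Primcodable Turing.Dir := .ofEquiv _ (Finite.equivFin Turing.Dir)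

instance (M : TM) : Finite M.Q := M.finQ

instance (M : TM) : Finite M.A := M.finA

noncomputable instance (M : TM) : Primcodable M.Q := .ofEquiv _ (Finite.equivFin M.Q)

noncomputable instance (M : TM) : Primcodable (Sym M.A) := .ofEquiv _ (Finite.equivFin (Sym M.A))

theorem primrec_scons {Γ : Type} [Inhabited Γ] [Primcodable Γ] :
    Primrec₂ (scons : Γ → List Γ → List Γ) := by
  classical
  exact Primrec.ite ((Primrec.eq.comp .fst (.const default)).and (Primrec.eq.comp .snd (.const [])))
    (.const []) (Primrec.list_cons.comp .fst .snd)

variable (M : TM)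

theorem primrec_actR : Primrec₂ (actR : Sym M.A × Option Turing.Dir →
    List (Sym M.A) × Sym M.A × List (Sym M.A) → _) := by
  classical
  have a₁ : Primrec fun x : (Sym M.A × Option Turing.Dir) ×
    (List (Sym M.A) × Sym M.A × List (Sym M.A)) => x.1.1 := Primrec.fst.comp .fst
  have a₂ : Primrec fun x : (Sym M.A × Option Turing.Dir) ×
    (List (Sym M.A) × Sym M.A × List (Sym M.A)) => x.1.2 := Primrec.snd.comp .fst
  have t₁ : Primrec fun x : (Sym M.A × Option Turing.Dir) ×
    (List (Sym M.A) × Sym M.A × List (Sym M.A)) => x.2.1 := Primrec.fst.comp .snd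
  have t₃ : Primrec fun x : (Sym M.A × Option Turing.Dir) ×
    (List (Sym M.A) × Sym M.A × List (Sym M.A)) => x.2.2.2 :=
    Primrec.snd.comp (Primrec.snd.comp .snd)
  exact Primrec.ite (Primrec.eq.comp a₂ (.const none)) (t₁.pair (a₁.pair t₃))
    (Primrec.ite (Primrec.eq.comp a₂ (.const (some Turing.Dir.left)))
      ((Primrec.list_tail.comp t₁).pair
        ((Primrec.list_headI.comp t₁).pair (primrec_scons.comp a₁ t₃)))
      ((primrec_scons.comp a₁ t₁).pair
        ((Primrec.list_headI.comp t₃).pair (Primrec.list_tail.comp t₃))))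

/-- The transition table has a finite domain; the rest is list manipulation. -/
theorem primrec_stepR : Primrec M.stepR := by
  have hδ : Primrec fun x : M.Q × (Fin (M.k + 1) → Sym M.A) => M.δ x.1 x.2 := Primrec.dom_finite _
  have heads : Primrec fun c : M.CfgR => fun i => (c.2 i).2.1 :=
    Primrec.fin_curry.2 (Primrec.fst.comp (Primrec.snd.comp
      (Primrec.fin_app.comp (Primrec.snd.comp .fst) .snd)))
  have acts : Primrec₂ fun (x : M.CfgR × M.Q)
      (p : Option M.Q × (Fin (M.k + 1) → Sym M.A × Option Turing.Dir)) =>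
      (p.1, fun i => actR (p.2 i) (x.1.2 i)) := by
    refine Primrec.pair (Primrec.fst.comp .snd) (Primrec.fin_curry.2 ?_)
    exact (primrec_actR M).comp
      (Primrec.fin_app.comp (Primrec.snd.comp (Primrec.snd.comp .fst)) .snd)
      (Primrec.fin_app.comp (Primrec.snd.comp (Primrec.fst.comp (Primrec.fst.comp .fst))) .snd)
  exact Primrec.option_bind .fst
    (Primrec.option_map (hδ.comp (Primrec.pair .snd (heads.comp .fst))) acts)

theorem primrec_runR : Primrec₂ M.runR :=
  Primrec.nat_iterate .fst (Primrec.option_some.comp .snd)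
    (Primrec.option_bind .snd ((primrec_stepR M).comp .snd))

theorem primrec_wordR : Primrec (wordR M.A) := by
  have : Primrec fun w : List Bool => w.map (Sym.bit : Bool → Sym M.A) :=
    Primrec.list_map .id ((Primrec.dom_finite _).comp .snd)
  exact (Primrec.const []).pair ((Primrec.list_headI.comp this).pair (Primrec.list_tail.comp this))

theorem primrec_cleanR (q : Option M.Q) : Primrec (M.cleanR q) := by
  refine (Primrec.const q).pair (Primrec.fin_curry.2 ?_)
  exact Primrec.ite (Primrec.eq.comp .snd (.const 0)) ((primrec_wordR M).comp .fst)
    (.const _)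

variable {α : Type} [Primcodable α] {w u : α → List Bool} {n : α → ℕ}

theorem primrec_outputsAt (hw : Primrec w) (hu : Primrec u) (hn : Primrec n) :
    PrimrecPred fun a => M.OutputsAt (w a) (u a) (n a) := by
  refine Primrec.eq.comp (Primrec.option_map
    ((primrec_runR M).comp hn ((primrec_cleanR M _).comp hw)) ?_)
    (Primrec.option_some.comp ((Primrec.const none).pair ((primrec_wordR M).comp hu)))
  exact (Primrec.fst.comp .snd).pair
    (Primrec.fin_app.comp (Primrec.snd.comp .snd) (.const 0))

theorem primrec_outputsCleanAt (hw : Primrec w) (hu : Primrec u) (hn : Primrec n) :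
    PrimrecPred fun a => M.OutputsCleanAt (w a) (u a) (n a) :=
  Primrec.eq.comp ((primrec_runR M).comp hn ((primrec_cleanR M _).comp hw))
    (Primrec.option_some.comp ((primrec_cleanR M none).comp hu))

theorem primrec_pair (hw : Primrec w) (hu : Primrec u) :
    Primrec fun a => pair (w a) (u a) := by
  have : Primrec fun a => (w a).map fun _ => true := Primrec.list_map hw (.const true)
  refine (Primrec.list_append.comp this (Primrec.list_cons.comp (.const false)
    (Primrec.list_append.comp hw hu))).of_eq fun a => ?_
  simp [pair, List.map_const']

theorem num_append_singleton (v : List Bool) (b : Bool) :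
    num (v ++ [b]) = 2 * num v + b.toNat := by
  have : posNum (v ++ [b]) = PosNum.bit b (posNum v) := by simp [posNum]
  rw [num, this, num]
  cases b <;> simp [PosNum.bit] <;> ring

theorem num_eq_foldl (v : List Bool) : num v = v.foldl (fun m b => 2 * m + b.toNat) 1 := by
  induction v using List.reverseRecOn with
  | nil => rfl
  | append_singleton v b ih => simp [num_append_singleton, ih]

theorem primrec_num : Primrec num := by
  refine (Primrec.list_foldl (f := id) (g := fun _ => 1)
    (h := fun _ x => 2 * x.1 + x.2.toNat) .id (.const 1) ?_).of_eq fun v => (num_eq_foldl v).symm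
  exact Primrec.nat_add.comp
    (Primrec.nat_mul.comp (.const 2) (Primrec.fst.comp .snd))
    ((Primrec.dom_finite Bool.toNat).comp (Primrec.snd.comp .snd))

theorem bitΓ'_injective : Injective bitΓ' := by
  rintro (_ | _) (_ | _) h <;> first | rfl | cases h

theorem num_injective : Injective num := by
  intro v v' h
  have := congrArg Turing.PartrecToTM2.trNat h
  rw [trNat_num, trNat_num] at this
  simpa [List.map_injective_iff.2 bitΓ'_injective |>.eq_iff] using this

/-- `word` deletes the leading binary digit of `m + 1`, and `num` puts it back. -/
theorem num_word (m : ℕ) : num (word m) = m + 1 := by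
  have key : ∀ m : ℕ, m ≠ 0 → num m.bits.dropLast.reverse = m := by
    intro m
    induction m using Nat.binaryRec' with
    | zero => simp
    | bit b m hb ih =>
      intro _
      rw [Nat.bits_append_bit m b hb]
      by_cases h : m = 0
      · subst h
        simp [hb rfl, num, posNum]
      · have : m.bits ≠ [] := by
          intro h'
          have := congrArg List.length h'
          rw [Nat.size_eq_bits_len] at this
          exact h (Nat.size_eq_zero.1 this)
        rw [List.dropLast_cons_of_ne_nil this, List.reverse_cons, num_append_singleton, ih h,
          Nat.bit_val]
  exact key _ (Nat.succ_ne_zero m)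

theorem length_word_le (m : ℕ) : (word m).length ≤ Nat.log 2 m + 1 := by
  -- Passing from `m` to `m + 1` can add a binary digit; dropping the leading digit makes up for it.
  have h : (m + 1).size ≤ Nat.log 2 m + 2 := by
    rw [Nat.size_le]
    have := Nat.lt_pow_succ_log_self (b := 2) (by decide) m
    rw [pow_succ]
    rw [Nat.succ_eq_add_one] at this
    have h1 : 1 ≤ 2 ^ (Nat.log 2 m + 1) := Nat.one_le_two_pow
    omega
  rw [← Nat.size_eq_bits_len] at h
  simp [word]
  omega

/-- Search for a witness `a` of `P (w, a)`, and return `h a`. -/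
theorem exists_search_code {P : List Bool × α → Prop} (hP : PrimrecPred P) {h : α → List Bool}
    (hh : Primrec h) : ∃ c : Turing.ToPartrec.Code, ∀ w, (∃ a, P (w, a)) →
      ∃ a, P (w, a) ∧ [num (h a)] ∈ c.eval [num w] := by
  classical
  -- The input number `m` is never decoded: the search runs over pairs of a word and a witness, and
  -- keeps those whose word has number `m`. By `num_injective` that word is the input.
  let f : ℕ → ℕ → Option ℕ := fun m n => (Encodable.decode n : Option (List Bool × α)).bind
    fun x => if num x.1 = m ∧ P x then some (num (h x.2)) else none
  have hf : Primrec₂ f := by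
    refine Primrec.option_bind (Primrec.decode.comp .snd) (Primrec.ite ?_ ?_ (.const none))
    · exact (Primrec.eq.comp (primrec_num.comp (Primrec.fst.comp .snd))
        (Primrec.fst.comp .fst)).and (hP.comp .snd)
    · exact Primrec.option_some.comp (primrec_num.comp (hh.comp (Primrec.snd.comp .snd)))
  have hF : Partrec fun m => Nat.rfindOpt (f m) := Partrec.rfindOpt hf.to_comp
  obtain ⟨c, hc⟩ := Turing.ToPartrec.Code.exists_code (Nat.Partrec'.part_iff₁.2 hF)
  refine ⟨c, fun w ⟨a, ha⟩ => ?_⟩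
  have hd : (Nat.rfindOpt (f (num w))).Dom := by
    refine Nat.rfindOpt_dom.2 ⟨Encodable.encode (w, a), num (h a), ?_⟩
    simp [f, ha]
  obtain ⟨r, hr⟩ := Part.dom_iff_mem.1 hd
  obtain ⟨n, hn⟩ := Nat.rfindOpt_spec hr
  obtain ⟨⟨w', b⟩, -, hb⟩ := Option.bind_eq_some_iff.1 hn
  split_ifs at hb with hb'
  obtain ⟨hw, hPb⟩ := hb'
  obtain rfl := num_injective hw
  obtain rfl := Option.some_injective _ hb
  refine ⟨b, hPb, ?_⟩
  have := hc (num w' ::ᵥ List.Vector.nil)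
  simp only [List.Vector.head_cons] at this
  change c.eval [num w'] = _ at this
  rw [this]
  exact Part.mem_map _ hr

end Primrec

/-! ### Uniqueness of outputs, and of inputs of reversible machines -/

theorem length_pair (x y : List Bool) : (pair x y).length = 2 * x.length + 1 + y.length := by
  simp [pair]
  ring

theorem pair_inj {x y x' y' : List Bool} (h : pair x y = pair x' y') : x = x' ∧ y = y' := by
  have key : ∀ (m n : ℕ) (u v : List Bool), List.replicate m true ++ false :: u =
      List.replicate n true ++ false :: v → m = n ∧ u = v := by
    intro m
    induction m with
    | zero =>
      rintro (_ | n) u v h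
      · simpa using h
      · simp [List.replicate_succ] at h
    | succ m ih =>
      rintro (_ | n) u v h
      · simp [List.replicate_succ] at h
      · obtain ⟨h₁, h₂⟩ := ih n u v (by simpa [List.replicate_succ] using h)
        exact ⟨by rw [h₁], h₂⟩
  obtain ⟨h₁, h₂⟩ := key _ _ _ _ h
  exact List.append_inj h₂ h₁

theorem wordTape_injective (A : Type) : Injective (wordTape A) := by
  intro w w' h
  have := congrArg reprTape h
  rw [reprTape_word, reprTape_word] at this
  simp only [wordR, Prod.mk.injEq, true_and] at this
  have hinj : Injective (Sym.bit : Bool → Sym A) := fun a b h => by cases h; rfl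
  obtain _ | ⟨a, w⟩ := w <;> obtain _ | ⟨b, w'⟩ := w'
  · rfl
  · cases this.1
  · cases this.1
  · simp only [List.map_cons, List.headI_cons, List.tail_cons] at this
    rw [hinj this.1, List.map_injective_iff.2 hinj this.2]

namespace TM

variable {M : TM}

theorem run_succ' (n : ℕ) (c : Cfg M) : M.run (n + 1) c = (M.run n c).bind M.step := by
  induction n generalizing c with
  | zero => simp only [run, Option.bind_some]; cases M.step c <;> rfl
  | succ n ih =>
    rw [run, run]
    cases M.step c with
    | none => rfl
    | some c' => exact ih c'

theorem run_halted {c : Cfg M} (h : c.state = none) {n : ℕ} {c' : Cfg M}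
    (hn : M.run n c = some c') : c' = c := by
  cases n with
  | zero => exact (Option.some_injective _ hn).symm
  | succ n => simp [run, step, h] at hn

theorem run_unique {c a b : Cfg M} (ha : a.state = none) (hb : b.state = none) {m n : ℕ}
    (hm : M.run m c = some a) (hn : M.run n c = some b) : a = b := by
  induction m generalizing n c with
  | zero =>
    obtain rfl := Option.some_injective _ hm
    exact (run_halted ha hn).symm
  | succ m ih =>
    cases n with
    | zero =>
      obtain rfl := Option.some_injective _ hn
      exact run_halted hb hm
    | succ n =>
      rw [run] at hm hn
      obtain ⟨c', hc, hm⟩ := Option.bind_eq_some_iff.1 hm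
      rw [hc] at hn
      exact ih hm hn

theorem Outputs.unique {w u v : List Bool} (hu : M.Outputs w u) (hv : M.Outputs w v) : u = v := by
  obtain ⟨_, m, _, a, hm, ha, hau⟩ := hu
  obtain ⟨_, n, _, b, hn, hb, hbv⟩ := hv
  rw [run_unique ha hb hm hn] at hau
  exact wordTape_injective _ (hau.symm.trans hbv)

/-- Both runs are followed backwards along unique predecessors. They reach their beginnings
simultaneously, because the start state is never entered. -/
theorem Reversible.init_unique (hM : M.Reversible) {w w' : List Bool} {c : Cfg M} {m n : ℕ}
    (hm : M.run m (M.init w) = some c) (hn : M.run n (M.init w') = some c) :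
    M.init w = M.init w' := by
  induction m generalizing n c with
  | zero =>
    obtain rfl := Option.some_injective _ hm
    cases n with
    | zero => exact (Option.some_injective _ hn).symm
    | succ n =>
      rw [run_succ'] at hn
      obtain ⟨c', -, hc⟩ := Option.bind_eq_some_iff.1 hn
      exact absurd rfl (hM.2 _ _ hc)
  | succ m ih =>
    rw [run_succ'] at hm
    obtain ⟨a, ha, hac⟩ := Option.bind_eq_some_iff.1 hm
    cases n with
    | zero =>
      obtain rfl := Option.some_injective _ hn
      exact absurd rfl (hM.2 _ _ hac)
    | succ n =>
      rw [run_succ'] at hn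
      obtain ⟨b, hb, hbc⟩ := Option.bind_eq_some_iff.1 hn
      rw [← hM.1 _ _ _ hac hbc] at hb
      exact ih ha hb

/-- With nothing else left on the tapes, the output determines the whole final description, so
`init_unique` applies. -/
theorem Reversible.outputsClean_injective (hM : M.Reversible) {w w' u : List Bool}
    (h : M.OutputsClean w u) (h' : M.OutputsClean w' u) : w = w' := by
  obtain ⟨m, hm⟩ := h
  obtain ⟨n, hn⟩ := h'
  have := congrFun (congrArg Cfg.tape (hM.init_unique hm hn)) 0
  exact wordTape_injective _ (by simpa [init, cleanCfg] using this)

end TM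

/-! ### The complexity bounds -/

theorem IsUniversal.exists_index {U : TM} (hU : IsUniversal U) {c : Turing.ToPartrec.Code} :
    ∃ i : List Bool, ∀ p y u, [num u] ∈ c.eval [num (pair p y)] →
      U.Outputs (pair (pair i p) y) u := by
  obtain ⟨T, hT⟩ := exists_outputs c
  obtain ⟨i, hi⟩ := hU T
  exact ⟨i, fun p y u h => (hi p y u).2 (hT _ _ h)⟩

theorem condC_le {U : TM} {p x y : List Bool} (h : U.Outputs (pair p y) x) :
    condC U x y ≤ p.length :=
  iInf₂_le p h

theorem exists_outputs_of_condC_lt_top {U : TM} {x y : List Bool} (h : condC U x y < ⊤) :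
    ∃ p, U.Outputs (pair p y) x ∧ condC U x y = p.length := by
  have hne : Nonempty {p : List Bool // U.Outputs (pair p y) x} := by
    by_contra hne
    rw [nonempty_subtype, not_exists] at hne
    simp [condC, hne] at h
  obtain ⟨⟨p, hp⟩, hmin⟩ := ENat.exists_eq_iInf
    fun p : {p : List Bool // U.Outputs (pair p y) x} => (p.1.length : ℕ∞)
  exact ⟨p, hp, by rw [condC, iInf_subtype', ← hmin]⟩

/-- An index `i` for the projection `⟨p, y⟩ ↦ p` makes `⟨i, p⟩` a program for `p`; the constant is
the length that pairing with `i` adds. -/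
theorem IsUniversal.exists_condC_le_length {U : TM} (hU : IsUniversal U) :
    ∃ c : ℕ, ∀ p y : List Bool, condC U p y ≤ (p.length + c : ℕ) := by
  have hP : PrimrecPred fun x : List Bool × (List Bool × List Bool) =>
      pair x.2.1 x.2.2 = x.1 :=
    Primrec.eq.comp (primrec_pair (Primrec.fst.comp .snd) (Primrec.snd.comp .snd)) .fst
  obtain ⟨c, hc⟩ := exists_search_code hP Primrec.fst
  obtain ⟨i, hi⟩ := hU.exists_index (c := c)
  refine ⟨2 * i.length + 1, fun p y => ?_⟩
  obtain ⟨⟨p', y'⟩, h, hmem⟩ := hc (pair p y) ⟨(p, y), rfl⟩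
  obtain ⟨rfl, rfl⟩ : p' = p ∧ y' = y := pair_inj h
  refine (condC_le (hi _ _ _ hmem)).trans ?_
  rw [length_pair]
  exact_mod_cast (by omega)

theorem IsUniversal.condC_lt_top {U : TM} (hU : IsUniversal U) (x y : List Bool) :
    condC U x y < ⊤ := by
  obtain ⟨c, hc⟩ := hU.exists_condC_le_length
  exact (hc x y).trans_lt (ENat.natCast_lt_top _)

theorem C_le_Ct (U : TM) (t : ℕ → ℕ) (x : List Bool) : C U x ≤ Ct U t x :=
  le_iInf₂ fun _ hp => condC_le ⟨_, hp⟩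

/-- The sequence is eventually constant: one shortest program halts within some `m` steps, and
eventually `t n |x| ≥ m`. -/
theorem IsUniversal.tendsto_Ct {U : TM} (hU : IsUniversal U) (x : List Bool) {t : ℕ → ℕ → ℕ}
    (ht : Tendsto (fun n => t n x.length) atTop atTop) :
    Tendsto (fun n => Ct U (t n) x) atTop (𝓝 (C U x)) := by
  obtain ⟨p, ⟨m, k, hk, hp⟩, hC⟩ := exists_outputs_of_condC_lt_top (hU.condC_lt_top x [])
  refine tendsto_const_nhds.congr' ?_
  filter_upwards [ht.eventually_ge_atTop m] with n hn
  refine (C_le_Ct U (t n) x).antisymm ?_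
  rw [C, hC]
  exact iInf₂_le p ⟨k, hk.trans hn, hp⟩

/-- If a reversible machine maps `⟨x, p⟩` to `⟨ε, q⟩`, then `x` can be computed from `q`. -/
theorem IsUniversal.exists_C_le_E {U R : TM} (hU : IsUniversal U) (hR : R.Reversible) :
    ∃ c : ℕ, ∀ x : List Bool, C U x ≤ E R x [] + c := by
  have hP : PrimrecPred fun a : List Bool × (List Bool × List Bool × List Bool × ℕ) =>
      a.1 = pair a.2.2.2.1 [] ∧ R.OutputsCleanAt (pair a.2.1 a.2.2.1) (pair [] a.2.2.2.1)
        a.2.2.2.2 := by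
    have h₁ := Primrec.snd (α := List Bool) (β := List Bool × List Bool × List Bool × ℕ)
    have h₂ := Primrec.snd.comp h₁
    have h₃ := Primrec.snd.comp h₂
    exact (Primrec.eq.comp .fst (primrec_pair (Primrec.fst.comp h₃) (.const []))).and
      (primrec_outputsCleanAt R (primrec_pair (Primrec.fst.comp h₁) (Primrec.fst.comp h₂))
        (primrec_pair (.const []) (Primrec.fst.comp h₃)) (Primrec.snd.comp h₃))
  obtain ⟨c, hc⟩ := exists_search_code hP Primrec.fst
  obtain ⟨i, hi⟩ := hU.exists_index (c := c)
  refine ⟨2 * i.length + 1, fun x => ?_⟩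
  rw [E, ENat.iInf_add]
  refine le_iInf fun p => ?_
  rw [ENat.iInf_add]
  refine le_iInf fun q => ?_
  rw [ENat.iInf_add]
  refine le_iInf fun h => ?_
  obtain ⟨t, ht⟩ := (R.outputsClean_iff _ _).1 h
  obtain ⟨⟨x', p', q', t'⟩, ⟨hq, ht'⟩, hmem⟩ := hc (pair q []) ⟨(x, p, q, t), rfl, ht⟩
  obtain ⟨rfl, -⟩ := pair_inj hq
  -- The search may stop at any start that leads to `⟨ε, q⟩`; reversibility leaves `⟨x, p⟩` as the
  -- only one.
  obtain ⟨rfl, rfl⟩ := pair_inj (hR.outputsClean_injective h ((R.outputsClean_iff _ _).2 ⟨_, ht'⟩))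
  refine (condC_le (hi _ _ _ hmem)).trans ?_
  rw [length_pair]
  exact_mod_cast (by omega)

/-- Given `x` and a program `p` that computes `C(x)` from `x`, one finds a shortest program `z`
of `x`; given `z`, one finds `x`. -/
theorem exists_reversible_erasing {U : TM} (hU : IsUniversal U) :
    ∃ R : TM, R.Reversible ∧ ∀ x p : List Bool,
      U.Outputs (pair p x) (word (C U x).toNat) →
        ∃ z : List Bool, C U x = z.length ∧
          R.OutputsClean (pair x p) (pair [] (pair p z)) := by
  -- A witness is `((x, p, z), v, t, t')`: `p` outputs `v` on `x` at time `t`, and `z` outputs `x`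
  -- at time `t'`. For `v = word n` the condition on `num v` says `|z| = n`.
  have hP : PrimrecPred fun a : List Bool ×
      ((List Bool × List Bool × List Bool) × List Bool × ℕ × ℕ) =>
      a.1 = pair a.2.1.1 a.2.1.2.1 ∧
        U.OutputsAt (pair a.2.1.2.1 a.2.1.1) a.2.2.1 a.2.2.2.1 ∧
        num a.2.2.1 = a.2.1.2.2.length + 1 ∧
        U.OutputsAt (pair a.2.1.2.2 []) a.2.1.1 a.2.2.2.2 := by
    have h := Primrec.snd (α := List Bool)
      (β := (List Bool × List Bool × List Bool) × List Bool × ℕ × ℕ)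
    have hx := Primrec.fst.comp (Primrec.fst.comp h)
    have hp := Primrec.fst.comp (Primrec.snd.comp (Primrec.fst.comp h))
    have hz := Primrec.snd.comp (Primrec.snd.comp (Primrec.fst.comp h))
    have hv := Primrec.fst.comp (Primrec.snd.comp h)
    have ht := Primrec.snd.comp (Primrec.snd.comp h)
    exact (Primrec.eq.comp .fst (primrec_pair hx hp)).and
      ((primrec_outputsAt U (primrec_pair hp hx) hv (Primrec.fst.comp ht)).and
      ((Primrec.eq.comp (primrec_num.comp hv) (Primrec.succ.comp (Primrec.list_length.comp hz))).and
      (primrec_outputsAt U (primrec_pair hz (.const [])) hx (Primrec.snd.comp ht))))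
  have hQ : PrimrecPred fun a : List Bool × ((List Bool × List Bool × List Bool) × ℕ) =>
      a.1 = pair [] (pair a.2.1.2.1 a.2.1.2.2) ∧
        U.OutputsAt (pair a.2.1.2.2 []) a.2.1.1 a.2.2 := by
    have h := Primrec.snd (α := List Bool) (β := (List Bool × List Bool × List Bool) × ℕ)
    have hx := Primrec.fst.comp (Primrec.fst.comp h)
    have hp := Primrec.fst.comp (Primrec.snd.comp (Primrec.fst.comp h))
    have hz := Primrec.snd.comp (Primrec.snd.comp (Primrec.fst.comp h))
    exact (Primrec.eq.comp .fst (primrec_pair (.const []) (primrec_pair hp hz))).and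
      (primrec_outputsAt U (primrec_pair hz (.const [])) hx (Primrec.snd.comp h))
  have hf : Primrec fun a : (List Bool × List Bool × List Bool) × List Bool × ℕ × ℕ =>
      pair [] (pair a.1.2.1 a.1.2.2) :=
    primrec_pair (.const []) (primrec_pair (Primrec.fst.comp (Primrec.snd.comp .fst))
      (Primrec.snd.comp (Primrec.snd.comp .fst)))
  have hg : Primrec fun a : (List Bool × List Bool × List Bool) × ℕ => pair a.1.1 a.1.2.1 :=
    primrec_pair (Primrec.fst.comp .fst) (Primrec.fst.comp (Primrec.snd.comp .fst))
  obtain ⟨f, hf⟩ := exists_search_code hP hf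
  obtain ⟨g, hg⟩ := exists_search_code hQ hg
  obtain ⟨R, hR, h⟩ := exists_reversible f g
  refine ⟨R, hR, fun x p hp => ?_⟩
  obtain ⟨z₀, hz₀, hC⟩ := exists_outputs_of_condC_lt_top (hU.condC_lt_top x [])
  have hC' : (C U x).toNat = z₀.length := by rw [C, hC, ENat.toNat_natCast]
  obtain ⟨t, ht⟩ := (U.outputs_iff _ _).1 hp
  obtain ⟨t', ht'⟩ := (U.outputs_iff _ _).1 hz₀
  -- The shortest program `z₀` only shows that the search succeeds; the `z` that it finds may differ
  -- but has the same length.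
  obtain ⟨⟨⟨x', p', z⟩, v, s, s'⟩, ⟨hw, hs, hv, hs'⟩, hmem⟩ := hf (pair x p)
    ⟨((x, p, z₀), word (C U x).toNat, t, t'), rfl, ht, by rw [num_word, hC'], ht'⟩
  obtain ⟨rfl, rfl⟩ := pair_inj hw
  obtain rfl := hp.unique ((U.outputs_iff _ _).2 ⟨_, hs⟩)
  rw [num_word, Nat.add_right_cancel_iff, hC'] at hv
  refine ⟨z, by rw [C, hC, hv], h _ _ hmem ?_⟩
  obtain ⟨⟨⟨x', p', z'⟩, r⟩, ⟨hw, hr⟩, hmem⟩ := hg (pair [] (pair p z)) ⟨((x, p, z), s'), rfl, hs'⟩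
  obtain ⟨rfl, rfl⟩ := pair_inj (pair_inj hw).2
  -- `U` is deterministic, so running `z` backs up the inverse search: it can return no word but
  -- `x`.
  obtain rfl := TM.Outputs.unique ((U.outputs_iff _ _).2 ⟨_, hs'⟩) ((U.outputs_iff _ _).2 ⟨_, hr⟩)
  exact hmem

theorem exists_E_le {U UR : TM} (hU : IsUniversal U) (hUR : IsUniversalReversible UR) :
    ∃ c : ℕ, ∀ x : List Bool,
      E UR x [] ≤ C U x + c * (condC U (word (C U x).toNat) x + 1) := by
  obtain ⟨R, hR, h⟩ := exists_reversible_erasing hU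
  obtain ⟨c, hc⟩ := hUR.2 R hR
  -- The cost for `R` is `|p| + (2|p| + 1 + |z|) = C(x) + 3|p| + 1`, and universality adds `c`.
  refine ⟨c + 3, fun x => ?_⟩
  obtain ⟨p, hp, hpC⟩ := exists_outputs_of_condC_lt_top
    (hU.condC_lt_top (word (C U x).toNat) x)
  obtain ⟨z, hz, hxz⟩ := h x p hp
  have hE : E R x [] ≤ ((p.length + (pair p z).length : ℕ) : ℕ∞) :=
    (iInf_le _ p).trans ((iInf_le _ (pair p z)).trans (iInf_le _ hxz))
  refine (hc x []).trans ((add_le_add_left hE _).trans ?_)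
  rw [hpC, hz, length_pair]
  norm_cast
  nlinarith [Nat.zero_le (c * p.length)]

theorem exists_E_le_log {U UR : TM} (hU : IsUniversal U) (hUR : IsUniversalReversible UR) :
    ∃ c : ℕ, ∀ x : List Bool,
      E UR x [] ≤ C U x + ((c * (Nat.log 2 (C U x).toNat + 1) : ℕ) : ℕ∞) := by
  obtain ⟨c, hc⟩ := exists_E_le hU hUR
  obtain ⟨d, hd⟩ := hU.exists_condC_le_length
  -- With `L` the logarithm, the factor to be bounded is at most `L + d + 2 ≤ (d + 2)(L + 1)`.
  refine ⟨c * (d + 2), fun x => (hc x).trans (add_le_add_right ?_ _)⟩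
  have h := (hd (word (C U x).toNat) x).trans
    (Nat.cast_le.2 (Nat.add_le_add_right (length_word_le (C U x).toNat) d))
  calc (c : ℕ∞) * (condC U (word (C U x).toNat) x + 1)
      ≤ c * (((Nat.log 2 (C U x).toNat + 1 + d : ℕ) : ℕ∞) + 1) := by gcongr
    _ ≤ _ := by
      norm_cast
      rw [mul_assoc]
      refine Nat.mul_le_mul_left c ?_
      nlinarith [Nat.zero_le (d * Nat.log 2 (C U x).toNat)]

end RevComp

theorem mainTheorem9 (U UR : RevComp.TM) (hU : RevComp.IsUniversal U)
    (hUR : RevComp.IsUniversalReversible UR) :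
    (∀ x : List Bool, RevComp.C U x < ⊤ ∧
      ∀ t : ℕ → ℕ → ℕ, Tendsto (fun n => t n x.length) atTop atTop →
        Tendsto (fun n => RevComp.Ct U (t n) x) atTop (𝓝 (RevComp.C U x))) ∧
    (∃ c : ℕ, ∀ x : List Bool, RevComp.C U x ≤ RevComp.E UR x [] + c) ∧
    (∃ c : ℕ, ∀ x : List Bool,
      RevComp.E UR x [] ≤
        RevComp.C U x + c * (RevComp.condC U (RevComp.word (RevComp.C U x).toNat) x + 1)) ∧
    (∃ c : ℕ, ∀ x : List Bool,
      RevComp.E UR x [] ≤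
        RevComp.C U x + ((c * (Nat.log 2 (RevComp.C U x).toNat + 1) : ℕ) : ℕ∞)) :=
  ⟨fun x => ⟨hU.condC_lt_top x [], fun _ ht => hU.tendsto_Ct x ht⟩, hU.exists_C_le_E hUR.1,
    RevComp.exists_E_le hU hUR, RevComp.exists_E_le_log hU hUR⟩
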